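/- **Setting.** There are $m$ businesses and $r$ screens. Business $j$ has a price $P_j\ge 0$ and screen parameters $\pi_{j1},\dots,\pi_{jr}\in(0,1]$. Consumers $i=1,2,\dots$ arrive one per round. Consumer $i$ has a value $V_i$, drawn i.i.d. from a distribution $\mathcal D^V$ on a bounded interval $[0,\overline V]$, and for each business $j$ a sequence of binary screens $(f_{ij1},\dots,f_{ijr})$, drawn independently over consumers and businesses and independently of the values, with $\Pr[f_{ij\ell}=1\mid f_{ij1}=\dots=f_{ij,\ell-1}=1]=\pi_{j\ell}$ (within a sequence the screens may otherwise be correlated). For a search degree $k\le r$ put $F_{ij}=\prod_{\ell\le k}f_{ij\ell}$ (fit), $q_{ij}=\prod_{\ell>k}f_{ij\ell}$ (quality realization), $\pi_j=\prod_{\ell\le k}\pi_{j\ell}$ (fit probability) and $Q_j=\prod_{\ell>k}\pi_{j\ell}$ (quality), and assume $\pi_j\in(0,1)$. A consumer adaptively inspects businesses at cost $c\ge 0$ each, then transacts with at most one inspected business; her utility is $V_i F_{ij}q_{ij}-P_j$ from a transaction with $j$ ($0$ without a transaction), minus the total inspection cost. *Transcribed sequential screening of degree $k$*: after each round the public history records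 which businesses were inspected, for each of them the first failed screen $\ell\le k$ if $F_{ij}=0$ (or that $F_{ij}=1$), which business was transacted with, if any, and for it the first failed screen $\ell>k$ if $q_{ij}=0$ (or that $q_{ij}=1$). The parameters $\pi_{j\ell}$ are unknown to consumers, who have a common prior under which the $\pi_{j\ell}$ are independent over $j$ and $\ell$; each true $\pi_{j\ell}$ lies in the support of its prior. Consumers see the public history and are Bayesian; let $\hat\pi_j,\hat Q_j$ be the posterior means of $\pi_j,Q_j$. A consumer with value $V$ follows the optimal index rule: she inspects the businesses with positive index $V\hat Q_j-P_j-c/\hat\pi_j$ in an order of non-increasing index (index ties between businesses being broken arbitrarily, measurably in $V$), until the first fit, and then transacts with that business. For a realized infinite history of a market $\mathcal M$, the *learned set* $\mathcal L(\mathcal M)$ consists of the businesses $j$ for which the posterior beliefs on $(\pi_j,Q_j)$ converge in probability to the true $(\pi_j,Q_j)$. For a set $S$ of businesses, $U^*(S)$ is the optimal expected utility of a consumer (with value drawn from $\mathcal D^V$) who knows the true $(\pi_j,Q_j)$ for $j\in S$ and can use only businesses in $S$. The *limit consumer utility* is $U(\mathcal M)=U^*(\mathcal L(\mathcal M))$.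 **Theorem.** Let $\mathcal M,\widetilde{\mathcal M}$ be markets with transcribed sequential screening that are identical except that $\mathcal M$ has search degree $k$ and $\widetilde{\mathcal M}$ has search degree $\tilde k$, with $k\le\tilde k\le r$. Then there is a coupling of the histories of $\mathcal M$ and $\widetilde{\mathcal M}$ (a joint law whose marginals are the laws of the two infinite histories) under which, almost surely, $$\mathcal L(\widetilde{\mathcal M})\supseteq\mathcal L(\mathcal M)\qquad\text{and}\qquad U(\widetilde{\mathcal M})\ge U(\mathcal M).$$ -/

import Mathlib

open MeasureTheory ProbabilityTheory Filter Topology Set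
open scoped ENNReal

namespace AgenticMarket

noncomputable section

/-! ### Search plans of a single consumer -/

/-- An adaptive search plan over `m` businesses: either stop and (possibly) name one business to
transact with, or inspect a business and continue according to whether it is a fit. -/
inductive Plan (m : ℕ) : Type
  | halt (choice : Option (Fin m)) : Plan m
  | inspect (j : Fin m) (ifFit ifNot : Plan m) : Plan m

/-- What a consumer has learned during her own search: `none` for a business that she has not
inspected, `some b` for an inspected business with fit `b`. -/
abbrev Knowledge (m : ℕ) : Type := Fin m → Option Bool

/-- Knowledge before any inspection. -/
def Knowledge.init (m : ℕ) : Knowledge m := fun _ => none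

/-- Carry out a plan when the realized fits are `F`. The result is the final knowledge and the
business transacted with, if any. Only an inspected business can be transacted with. -/
def Plan.run {m : ℕ} (F : Fin m → Bool) : Plan m → Knowledge m → Knowledge m × Option (Fin m)
  | .halt o, κ => (κ, o.filter (fun j => (κ j).isSome))
  | .inspect j a b, κ =>
      if F j then a.run F (Function.update κ j (some true))
      else b.run F (Function.update κ j (some false))

/-- The plan never inspects a business outside `S` (so it never transacts with one either). -/
def Plan.Within {m : ℕ} (S : Set (Fin m)) : Plan m → Prop
  | .halt _ => True
  | .inspect j a b => j ∈ S ∧ a.Within S ∧ b.Within S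

/-- Probability of fit of business `j`, given the knowledge `κ` and ex ante fit probabilities. -/
def fitChance {m : ℕ} (fit : Fin m → ℝ) (κ : Knowledge m) (j : Fin m) : ℝ :=
  match κ j with
  | none => fit j
  | some true => 1
  | some false => 0

/-- Expected total utility of a plan, from knowledge `κ` on, for a consumer with value `v` who pays
`c` per inspection and attributes fit probability `fit j` and quality `qual j` to business `j`
(independently over businesses, and fit independently of quality realization). A transaction with
an inspected business `j` costs `price j` and yields `v` with probability `qual j` if `j` is a fit,
and nothing otherwise. -/
def Plan.eu {m : ℕ} (c v : ℝ) (price fit qual : Fin m → ℝ) : Plan m → Knowledge m → ℝ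
  | .halt none, _ => 0
  | .halt (some j), κ =>
      match κ j with
      | none => 0
      | some true => v * qual j - price j
      | some false => - price j
  | .inspect j a b, κ =>
      - c + fitChance fit κ j * a.eu c v price fit qual (Function.update κ j (some true))
        + (1 - fitChance fit κ j) * b.eu c v price fit qual (Function.update κ j (some false))

/-- The search index `v Q - P - c / π`. -/
def searchIndex (c v price fit qual : ℝ) : ℝ := v * qual - price - c / fit

/-- Inspect the businesses of the list in order; transact with the first one that is a fit. -/
def indexPlan {m : ℕ} : List (Fin m) → Plan m
  | [] => .halt none
  | j :: l => .inspect j (.halt (some j)) (indexPlan l)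

/-- `l` lists exactly the businesses with positive index, in an order of non-increasing index. -/
def IsIndexOrder {m : ℕ} (idx : Fin m → ℝ) (l : List (Fin m)) : Prop :=
  l.Nodup ∧ (∀ j, j ∈ l ↔ 0 < idx j) ∧ l.Pairwise (fun i j => idx j ≤ idx i)

/-- The index rule: `p` inspects the businesses with positive index in an order of non-increasing
index (ties between businesses are broken arbitrarily), stopping with the first fit. -/
def FollowsIndexRule {m : ℕ} (idx : Fin m → ℝ) (p : Plan m) : Prop :=
  ∃ l, IsIndexOrder idx l ∧ p = indexPlan l

/-! ### The index rule is an optimal plan -/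

def wt (b : Bool) (p : ℝ) : ℝ := if b then p else 1 - p

def cap {m : ℕ} (σ : Fin m → ℝ) (F : Fin m → Bool) : NNReal :=
  (Finset.univ.filter (fun j => F j = true)).sup (fun j => (σ j).toNNReal)

def capMean {m : ℕ} (σ p : Fin m → ℝ) : ℝ :=
  ∑ F : Fin m → Bool, (∏ j, wt (F j) (p j)) * (cap σ F : ℝ)

lemma wt_split {m : ℕ} (p : Fin m → ℝ) (j : Fin m) (F : Fin m → Bool) :
    ∏ i, wt (F i) (p i) = p j * ∏ i, wt (F i) (Function.update p j 1 i)
      + (1 - p j) * ∏ i, wt (F i) (Function.update p j 0 i) := by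
  have key : ∀ t : ℝ, ∏ i, wt (F i) (Function.update p j t i)
      = wt (F j) t * ∏ i ∈ Finset.univ.erase j, wt (F i) (p i) := by
    intro t
    rw [← Finset.mul_prod_erase _ _ (Finset.mem_univ j)]
    congr 1
    · simp
    · refine Finset.prod_congr rfl fun i hi => ?_
      rw [Function.update_of_ne (Finset.ne_of_mem_erase hi)]
  rw [key, key, ← Finset.mul_prod_erase _ _ (Finset.mem_univ j)]
  cases F j <;> simp [wt]

lemma capMean_split {m : ℕ} (σ p : Fin m → ℝ) (j : Fin m) :
    capMean σ p = p j * capMean σ (Function.update p j 1)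
      + (1 - p j) * capMean σ (Function.update p j 0) := by
  unfold capMean
  rw [Finset.mul_sum, Finset.mul_sum, ← Finset.sum_add_distrib]
  refine Finset.sum_congr rfl fun F _ => ?_
  rw [wt_split p j F]; ring

lemma wt_sum {m : ℕ} (p : Fin m → ℝ) :
    ∑ F : Fin m → Bool, ∏ j, wt (F j) (p j) = 1 := by
  have := (Finset.prod_univ_sum (fun _ : Fin m => (Finset.univ : Finset Bool))
    (fun j b => wt b (p j))).symm
  rw [Fintype.piFinset_univ] at this
  rw [this]
  simp [wt]

lemma wt_nonneg {m : ℕ} {p : Fin m → ℝ} (hp : ∀ j, 0 ≤ p j ∧ p j ≤ 1)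
    (F : Fin m → Bool) : 0 ≤ ∏ j, wt (F j) (p j) := by
  refine Finset.prod_nonneg fun j _ => ?_
  unfold wt; split_ifs
  · exact (hp j).1
  · linarith [(hp j).2]

lemma capMean_nonneg {m : ℕ} (σ : Fin m → ℝ) {p : Fin m → ℝ}
    (hp : ∀ j, 0 ≤ p j ∧ p j ≤ 1) : 0 ≤ capMean σ p :=
  Finset.sum_nonneg fun F _ => mul_nonneg (wt_nonneg hp F) (NNReal.coe_nonneg _)

lemma le_capMean {m : ℕ} (σ : Fin m → ℝ) {p : Fin m → ℝ}
    (hp : ∀ j, 0 ≤ p j ∧ p j ≤ 1) (j : Fin m) (hj : p j = 1) : σ j ≤ capMean σ p := by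
  have h1 : σ j = ∑ F : Fin m → Bool, (∏ i, wt (F i) (p i)) * σ j := by
    rw [← Finset.sum_mul, wt_sum, one_mul]
  rw [h1]
  refine Finset.sum_le_sum fun F _ => ?_
  cases hF : F j
  · rw [Finset.prod_eq_zero (Finset.mem_univ j) (by simp [hF, hj, wt])]; simp
  · refine mul_le_mul_of_nonneg_left ?_ (wt_nonneg hp F)
    have : (σ j).toNNReal ≤ cap σ F :=
      Finset.le_sup (f := fun j => (σ j).toNNReal) (by simp [hF])
    exact (Real.le_coe_toNNReal _).trans (NNReal.coe_le_coe.2 this)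

lemma fitChance_update {m : ℕ} (fit : Fin m → ℝ) (κ : Knowledge m) (j : Fin m) (b : Bool) :
    fitChance fit (Function.update κ j (some b))
      = Function.update (fitChance fit κ) j (if b then 1 else 0) := by
  funext i
  by_cases h : i = j
  · subst h; cases b <;> simp [fitChance]
  · simp [fitChance, h]

lemma fitChance_mem {m : ℕ} {fit : Fin m → ℝ} (hf : ∀ j, 0 < fit j ∧ fit j ≤ 1)
    (κ : Knowledge m) (j : Fin m) : 0 ≤ fitChance fit κ j ∧ fitChance fit κ j ≤ 1 := by
  unfold fitChance
  split
  · exact ⟨(hf j).1.le, (hf j).2⟩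
  · norm_num
  · norm_num

def credit {m : ℕ} (c : ℝ) (fit : Fin m → ℝ) (κ : Knowledge m) : ℝ :=
  ∑ j, if κ j = some true then c / fit j else 0

lemma eu_le {m : ℕ} (c v : ℝ) (price fit qual : Fin m → ℝ) (hc : 0 ≤ c)
    (hP : ∀ j, 0 ≤ price j) (hf : ∀ j, 0 < fit j ∧ fit j ≤ 1) (p : Plan m) (κ : Knowledge m) :
    p.eu c v price fit qual κ ≤
      capMean (fun j => searchIndex c v (price j) (fit j) (qual j)) (fitChance fit κ)
        + credit c fit κ := by
  set σ := fun j => searchIndex c v (price j) (fit j) (qual j) with hσ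
  have hterm : ∀ (κ : Knowledge m) (i : Fin m),
      0 ≤ (if κ i = some true then c / fit i else 0) := by
    intro κ i; split_ifs
    · exact div_nonneg hc (hf i).1.le
    · exact le_rfl
  induction p generalizing κ with
  | halt o =>
    have h0 : 0 ≤ capMean σ (fitChance fit κ) + credit c fit κ :=
      add_nonneg (capMean_nonneg σ (fitChance_mem hf κ)) (Finset.sum_nonneg fun i _ => hterm κ i)
    cases o with
    | none => simpa [Plan.eu] using h0
    | some j =>
      rcases hk : κ j with _ | _ | _
      · simpa [Plan.eu, hk] using h0
      · simp only [Plan.eu, hk]; linarith [hP j]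
      · simp only [Plan.eu, hk]
        have h1 := le_capMean σ (fitChance_mem hf κ) j (by simp [fitChance, hk])
        have h2 : c / fit j ≤ credit c fit κ := by
          have h5 : (if κ j = some true then c / fit j else 0) ≤ credit c fit κ :=
            Finset.single_le_sum (fun i _ => hterm κ i) (Finset.mem_univ j)
          rwa [if_pos hk] at h5
        have h3 : σ j = v * qual j - price j - c / fit j := rfl
        linarith
  | inspect j a b iha ihb =>
    have ha := iha (Function.update κ j (some true))
    have hb := ihb (Function.update κ j (some false))
    rw [fitChance_update] at ha hb
    simp only [if_true, Bool.false_eq_true, if_false] at ha hb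
    have hcr : ∀ b : Bool, credit c fit (Function.update κ j (some b))
        = (if b then c / fit j else 0) + ∑ i ∈ Finset.univ.erase j,
            (if κ i = some true then c / fit i else 0) := by
      intro b
      unfold credit
      rw [← Finset.add_sum_erase _ _ (Finset.mem_univ j)]
      congr 1
      · simp
      · refine Finset.sum_congr rfl fun i hi => ?_
        rw [Function.update_of_ne (Finset.ne_of_mem_erase hi)]
    have hcr0 : credit c fit κ = (if κ j = some true then c / fit j else 0)
        + ∑ i ∈ Finset.univ.erase j, (if κ i = some true then c / fit i else 0) := by
      unfold credit
      rw [← Finset.add_sum_erase _ _ (Finset.mem_univ j)]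
    rw [hcr true] at ha
    rw [hcr false] at hb
    rw [capMean_split σ (fitChance fit κ) j, hcr0]
    simp only [if_true, Bool.false_eq_true, if_false] at ha hb
    simp only [Plan.eu]
    set A := a.eu c v price fit qual (Function.update κ j (some true))
    set B := b.eu c v price fit qual (Function.update κ j (some false))
    set WA := capMean σ (Function.update (fitChance fit κ) j 1)
    set WB := capMean σ (Function.update (fitChance fit κ) j 0)
    set R := ∑ i ∈ Finset.univ.erase j, (if κ i = some true then c / fit i else 0)
    have hm := fitChance_mem hf κ j
    have e1 := mul_le_mul_of_nonneg_left ha hm.1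
    have e2 := mul_le_mul_of_nonneg_left hb (by linarith [hm.2] : 0 ≤ 1 - fitChance fit κ j)
    have hq : fit j * (c / fit j) = c := mul_div_cancel₀ c (ne_of_gt (hf j).1)
    rcases hk : κ j with _ | _ | _
    · have hfc : fitChance fit κ j = fit j := by simp [fitChance, hk]
      rw [hfc] at e1 e2 ⊢
      simp only [reduceCtorEq, if_false]
      nlinarith
    · have hfc : fitChance fit κ j = 0 := by simp [fitChance, hk]
      rw [hfc] at e1 e2 ⊢
      simp
      linarith
    · have hfc : fitChance fit κ j = 1 := by simp [fitChance, hk]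
      rw [hfc] at e1 e2 ⊢
      simp
      linarith

lemma eu_indexPlan {m : ℕ} (c v : ℝ) (price fit qual : Fin m → ℝ)
    (hf : ∀ j, 0 < fit j ∧ fit j ≤ 1) (l : List (Fin m)) (κ : Knowledge m)
    (hn : l.Nodup) (h1 : ∀ j ∈ l, κ j = none)
    (h2 : ∀ j, j ∉ l → searchIndex c v (price j) (fit j) (qual j) ≤ 0 ∨ fitChance fit κ j = 0)
    (h3 : ∀ j ∈ l, 0 < searchIndex c v (price j) (fit j) (qual j))
    (h4 : l.Pairwise (fun i j => searchIndex c v (price j) (fit j) (qual j)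
      ≤ searchIndex c v (price i) (fit i) (qual i))) :
    (indexPlan l).eu c v price fit qual κ =
      capMean (fun j => searchIndex c v (price j) (fit j) (qual j)) (fitChance fit κ) := by
  set σ := fun j => searchIndex c v (price j) (fit j) (qual j) with hσ
  induction l generalizing κ with
  | nil =>
    simp only [indexPlan, Plan.eu]
    symm
    refine Finset.sum_eq_zero fun F _ => ?_
    by_cases hz : ∃ j, F j = true ∧ fitChance fit κ j = 0
    · obtain ⟨j, hj, hj0⟩ := hz
      rw [Finset.prod_eq_zero (Finset.mem_univ j) (by simp [hj, hj0, wt]), zero_mul]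
    · push Not at hz
      have : cap σ F = 0 := by
        rw [← bot_eq_zero, cap, Finset.sup_eq_bot_iff]
        intro j hj
        have hj : F j = true := by simpa using hj
        rcases h2 j (by simp) with h | h
        · simpa using h
        · exact absurd h (hz j hj)
      simp [this]
  | cons j l ih =>
    have hjn : κ j = none := h1 j (by simp)
    have hnd := List.nodup_cons.1 hn
    have hfc : fitChance fit κ j = fit j := by simp [fitChance, hjn]
    have IH := ih (Function.update κ j (some false)) hnd.2
      (fun i hi => by
        have hij : i ≠ j := by
          rintro rfl
          exact hnd.1 hi
        rw [Function.update_of_ne hij]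
        exact h1 i (List.mem_cons_of_mem _ hi))
      (fun i hi => by
        by_cases h : i = j
        · right; subst h; simp [fitChance]
        · have := h2 i (by simp [h, hi])
          rwa [fitChance_update, Function.update_of_ne h])
      (fun i hi => h3 i (List.mem_cons_of_mem _ hi)) (List.pairwise_cons.1 h4).2
    rw [fitChance_update] at IH
    have hA : capMean σ (Function.update (fitChance fit κ) j 1) = σ j := by
      have h1' : σ j = ∑ F : Fin m → Bool,
          (∏ i, wt (F i) (Function.update (fitChance fit κ) j 1 i)) * σ j := by
        rw [← Finset.sum_mul, wt_sum, one_mul]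
      rw [h1']
      refine Finset.sum_congr rfl fun F _ => ?_
      by_cases hz : ∃ i, wt (F i) (Function.update (fitChance fit κ) j 1 i) = 0
      · obtain ⟨i, hi⟩ := hz
        rw [Finset.prod_eq_zero (Finset.mem_univ i) hi, zero_mul, zero_mul]
      · push Not at hz
        congr 1
        have hFj : F j = true := by
          by_contra h
          exact hz j (by simp [h, wt])
        have hpos : 0 < σ j := h3 j (by simp)
        have hcap : cap σ F = (σ j).toNNReal := by
          refine le_antisymm (Finset.sup_le fun i hi => ?_)
            (Finset.le_sup (f := fun j => (σ j).toNNReal) (by simp [hFj]))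
          have hi : F i = true := by simpa using hi
          refine Real.toNNReal_le_toNNReal ?_
          by_cases hij : i = j
          · rw [hij]
          by_cases hil : i ∈ l
          · exact (List.pairwise_cons.1 h4).1 i hil
          · rcases h2 i (by simp [hij, hil]) with h | h
            · exact le_trans h hpos.le
            · exact absurd (by simp [hi, wt, hij, h]) (hz i)
        rw [hcap, Real.coe_toNNReal _ hpos.le]
    rw [capMean_split σ _ j, hA, hfc]
    simp only [indexPlan, Plan.eu, Function.update_self, hfc]
    simp only [Bool.false_eq_true, if_false] at IH
    rw [IH]
    have hq : fit j * (c / fit j) = c := mul_div_cancel₀ c (ne_of_gt (hf j).1)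
    have h3' : σ j = v * qual j - price j - c / fit j := rfl
    rw [h3']
    linear_combination hq

/-- A plan that follows the index rule maximizes expected utility among all adaptive plans. -/
theorem FollowsIndexRule.optimal {m : ℕ} {c v : ℝ} {price fit qual : Fin m → ℝ} (hc : 0 ≤ c)
    (hP : ∀ j, 0 ≤ price j) (hf : ∀ j, 0 < fit j ∧ fit j ≤ 1) {p : Plan m}
    (hp : FollowsIndexRule (fun j => searchIndex c v (price j) (fit j) (qual j)) p) (p' : Plan m) :
    p'.eu c v price fit qual (Knowledge.init m) ≤ p.eu c v price fit qual (Knowledge.init m) := by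
  obtain ⟨l, ⟨hn, hm, hs⟩, rfl⟩ := hp
  rw [eu_indexPlan c v price fit qual hf l (Knowledge.init m) hn (fun _ _ => rfl)
    (fun j hj => Or.inl (not_lt.1 fun h => hj ((hm j).2 h))) (fun j hj => (hm j).1 hj) hs]
  refine (eu_le c v price fit qual hc hP hf p' (Knowledge.init m)).trans (le_of_eq ?_)
  simp [credit, Knowledge.init]

/-! ### Screens, feedback and histories -/

/-- The first failed screen among those with (zero-based) number in `[lo, hi)`; `⊤` if none. -/
def firstFail {r : ℕ} (lo hi : ℕ) (f : Fin r → Bool) : WithTop (Fin r) :=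
  (Finset.univ.filter (fun l : Fin r => lo ≤ (l : ℕ) ∧ (l : ℕ) < hi ∧ f l = false)).min

/-- The fit at search degree `k`: all of the first `k` screens are passed. -/
def fitOf {r : ℕ} (k : ℕ) (f : Fin r → Bool) : Bool :=
  decide (∀ l : Fin r, (l : ℕ) < k → f l = true)

/-- The public feedback of one round with transcribed screening. `inspection j` is `none` if `j` was
not inspected, `some ⊤` if it was a fit, and `some l` if `l` was the first of the inspected screens
that failed. `transaction` is `none` if there was no transaction, `some (j, ⊤)` after a transaction
with `j` of quality realization `1`, and `some (j, l)` if the quality realization was `0` and `l`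
was the first of the remaining screens that failed. -/
structure Feedback (m r : ℕ) : Type where
  inspection : Fin m → Option (WithTop (Fin r))
  transaction : Option (Fin m × WithTop (Fin r))

instance (m r : ℕ) : MeasurableSpace (Feedback m r) := ⊤

/-- Feedback of a round in which the consumer carries out the plan `p` and the screens are `f`. -/
def roundFeedback {m r : ℕ} (k : ℕ) (p : Plan m) (f : Fin m → Fin r → Bool) : Feedback m r :=
  let res := p.run (fun j => fitOf k (f j)) (Knowledge.init m)
  { inspection := fun j => (res.1 j).map (fun _ => firstFail 0 k (f j))
    transaction := res.2.map (fun j => (j, firstFail k r (f j))) }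

/-- The consumers' behaviour: a plan for every public history of the earlier rounds and every
value of the current consumer. -/
abbrev Strategy (m r : ℕ) : Type := List (Feedback m r) → ℝ → Plan m

/-- Value and screens of one consumer. -/
abbrev Consumer (m r : ℕ) : Type := ℝ × (Fin m → Fin r → Bool)

/-- The public history after the first `n` rounds. -/
def historyUpTo {m r : ℕ} (k : ℕ) (s : Strategy m r) (ω : ℕ → Consumer m r) :
    ℕ → List (Feedback m r)
  | 0 => []
  | n + 1 => historyUpTo k s ω n ++ [roundFeedback k (s (historyUpTo k s ω n) (ω n).1) (ω n).2]

/-- The infinite public history. -/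
def history {m r : ℕ} (k : ℕ) (s : Strategy m r) (ω : ℕ → Consumer m r) : ℕ → Feedback m r :=
  fun n => roundFeedback k (s (historyUpTo k s ω n) (ω n).1) (ω n).2

/-- The first `n` rounds of an infinite history. -/
def historyPrefix {m r : ℕ} (H : ℕ → Feedback m r) (n : ℕ) : List (Feedback m r) :=
  (List.range n).map H

/-! ### Markets -/

/-- A profile of screen parameters: `x j l` is the probability that business `j` passes screen `l`
given that it passes all earlier screens. -/
abbrev Profile (m r : ℕ) : Type := Fin m → Fin r → unitInterval

/-- The fit probability at search degree `k`. -/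
def fitProb {r : ℕ} (k : ℕ) (x : Fin r → unitInterval) : ℝ :=
  ∏ l ∈ Finset.univ.filter (fun l : Fin r => (l : ℕ) < k), (x l : ℝ)

/-- The quality at search degree `k`. -/
def quality {r : ℕ} (k : ℕ) (x : Fin r → unitInterval) : ℝ :=
  ∏ l ∈ Finset.univ.filter (fun l : Fin r => k ≤ (l : ℕ)), (x l : ℝ)

/-- All data of a market with `m` businesses and `r` screens per business, except for the search
degree. -/
structure ScreenMarket (m r : ℕ) where
  /-- the true screen parameters -/
  param : Profile m r
  /-- prices -/
  price : Fin m → ℝ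
  /-- cost of one inspection -/
  cost : ℝ
  /-- distribution of the consumers' values -/
  valueLaw : Measure ℝ
  /-- common prior of each screen parameter; parameters are independent under the prior -/
  prior : Fin m → Fin r → Measure unitInterval
  /-- joint law of the screens of a business with given screen parameters -/
  screenLaw : Fin m → Kernel (Fin r → unitInterval) (Fin r → Bool)
  price_nonneg : ∀ j, 0 ≤ price j
  cost_nonneg : 0 ≤ cost
  isProb_valueLaw : IsProbabilityMeasure valueLaw
  bounded_valueLaw : ∃ vbar : ℝ, ∀ᵐ v ∂valueLaw, 0 ≤ v ∧ v ≤ vbar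
  isProb_prior : ∀ j l, IsProbabilityMeasure (prior j l)
  isMarkov_screenLaw : ∀ j, IsMarkovKernel (screenLaw j)
  /-- chain rule: `x l` is the probability of passing screen `l` given that all earlier screens are
  passed; the screens may otherwise be correlated in any way -/
  screenLaw_pass : ∀ j (x : Fin r → unitInterval) (l : Fin r),
    screenLaw j x {f | ∀ i ≤ l, f i = true} = ENNReal.ofReal (∏ i ∈ Finset.Iic l, (x i : ℝ))
  /-- the true parameters are a potential realization of the prior -/
  param_mem_support : ∀ j l, param j l ∈ (prior j l).support
  /-- every screen is passed with positive probability -/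
  param_pos : ∀ j l, 0 < (param j l : ℝ)

namespace ScreenMarket

variable {m r : ℕ}

attribute [instance] isProb_valueLaw isProb_prior isMarkov_screenLaw

/-- Law of one consumer's value and screens when the screen parameters are `x`; everything is
independent over businesses and of the value. -/
def consumerLaw (E : ScreenMarket m r) (x : Profile m r) : Measure (Consumer m r) :=
  E.valueLaw.prod (Measure.pi fun j => E.screenLaw j (x j))

instance (E : ScreenMarket m r) (x : Profile m r) : IsProbabilityMeasure (E.consumerLaw x) := by
  unfold consumerLaw; infer_instance

/-- Law of the infinite i.i.d. stream of consumers when the screen parameters are `x`. -/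
def streamLaw (E : ScreenMarket m r) (x : Profile m r) : Measure (ℕ → Consumer m r) :=
  Measure.infinitePi fun _ => E.consumerLaw x

/-- The prior over all screen parameters. -/
def jointPrior (E : ScreenMarket m r) : Measure (Profile m r) :=
  Measure.pi fun j => Measure.pi fun l => E.prior j l

/-- Probability of the finite public history `h` when the screen parameters are `x`. -/
def likelihood (E : ScreenMarket m r) (k : ℕ) (s : Strategy m r) (h : List (Feedback m r))
    (x : Profile m r) : ℝ≥0∞ :=
  E.streamLaw x {ω | historyUpTo k s ω h.length = h}

/-- The posterior over the screen parameters given the finite public history `h` (Bayes' rule). -/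
def posterior (E : ScreenMarket m r) (k : ℕ) (s : Strategy m r) (h : List (Feedback m r)) :
    Measure (Profile m r) :=
  (∫⁻ x, E.likelihood k s h x ∂E.jointPrior)⁻¹ • E.jointPrior.withDensity (E.likelihood k s h)

/-- Posterior mean fit of business `j`. -/
def meanFit (E : ScreenMarket m r) (k : ℕ) (s : Strategy m r) (h : List (Feedback m r))
    (j : Fin m) : ℝ :=
  ∫ x, fitProb k (x j) ∂E.posterior k s h

/-- Posterior mean quality of business `j`. -/
def meanQuality (E : ScreenMarket m r) (k : ℕ) (s : Strategy m r) (h : List (Feedback m r))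
    (j : Fin m) : ℝ :=
  ∫ x, quality k (x j) ∂E.posterior k s h

/-- The strategy of rational consumers at search degree `k`: after every public history, a consumer
with value `v` follows the index rule for the posterior means given that history, where the
posterior is formed knowing that all earlier consumers behaved according to the same strategy.
The plan depends measurably on the value. -/
structure IsRational (E : ScreenMarket m r) (k : ℕ) (s : Strategy m r) : Prop where
  measurable : ∀ h p, MeasurableSet {v | s h v = p}
  index_rule : ∀ h v, FollowsIndexRule
    (fun j => searchIndex E.cost v (E.price j) (E.meanFit k s h j) (E.meanQuality k s h j)) (s h v)

/-- Law of the infinite public history. -/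
def historyLaw (E : ScreenMarket m r) (k : ℕ) (s : Strategy m r) : Measure (ℕ → Feedback m r) :=
  (E.streamLaw E.param).map (history k s)

/-- The learned set of a history `H`: the businesses whose posterior beliefs on fit probability and
quality converge in probability to the true values along `H`. -/
def learnedSet (E : ScreenMarket m r) (k : ℕ) (s : Strategy m r) (H : ℕ → Feedback m r) :
    Set (Fin m) :=
  {j | ∀ ε : ℝ, 0 < ε →
    Tendsto (fun n => E.posterior k s (historyPrefix H n)
      {x | ε ≤ |fitProb k (x j) - fitProb k (E.param j)|}) atTop (𝓝 0) ∧
    Tendsto (fun n => E.posterior k s (historyPrefix H n)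
      {x | ε ≤ |quality k (x j) - quality k (E.param j)|}) atTop (𝓝 0)}

/-- `U*(S)`: the optimal expected utility of a consumer who knows the true fit probabilities and
qualities and can only use the businesses in `S`. -/
def optimalUtility (E : ScreenMarket m r) (k : ℕ) (S : Set (Fin m)) : ℝ :=
  ∫ v, (⨆ p : {p : Plan m // p.Within S},
    p.1.eu E.cost v E.price (fun j => fitProb k (E.param j)) (fun j => quality k (E.param j))
      (Knowledge.init m)) ∂E.valueLaw

/-- The limit consumer utility of a history. -/
def limitUtility (E : ScreenMarket m r) (k : ℕ) (s : Strategy m r) (H : ℕ → Feedback m r) : ℝ :=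
  E.optimalUtility k (E.learnedSet k s H)

end ScreenMarket

end

end AgenticMarket

namespace AgenticMarket

/-! ### Monotonicity of the optimal utility in the search degree -/

/-! The mechanism is that the information produced by an inspection does not depend on the search
degree. Under the index rule a fit is always followed by a transaction with that business, so
whether a screen fails during the inspection or after the transaction, the public learns exactly the
first failed screen of the whole sequence (`outcome_roundFeedback_eq`). The likelihood of a history
is then a factor depending on values only, times a product over businesses and screens
(`likelihood_eq_prod`), so the posterior on a business depends only on the list of its own outcomes
(`posterior_eq`).

The coupling gives both markets the same values and, for each business, the same stack of screen
sequences, the n-th inspection of the business using the n-th sequence. Since screens are never read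
twice, this leaves the law of each history unchanged (`map_process_congr`). After equally many
inspections of a business, both markets hold the same posterior on it.

Almost surely, infinitely many inspections identify a business, by the law of large numbers and
concentration of the likelihood (`tendsto_screenPosterior`). Suppose instead that the market of
larger degree stops inspecting it after `a` outcomes. Then its index there is nonpositive for almost
every value: otherwise consumers with positive index who meet no fit anywhere would keep arriving,
and each would inspect it (`IsRational.ae_finallyUnattractive_stream`). Multiplied by the mean fit,
the index is the value times the mean of the product of all parameters, minus mean fit times price,
minus cost; only the price term involves the degree, and it shrinks as the degree grows
(`Possible.outcomeIndex_pos`). So the index is nonpositive at the smaller degree too, and the other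
market never gets past `a` inspections. If that market nevertheless learned the business, its frozen
posterior is already degenerate, which pins down every screen parameter
(`identified_of_businessPosterior`), and further outcomes cannot undo this (`Identified.append`).

For utilities, the value of the index rule is the mean of the largest positive index among the fits,
`capMean`. Computed with the indices of the finer test, it serves as a potential bounding every plan
that uses the coarser test (`Plan.Within.eu_le_capMean`). -/

lemma capMean_affine {m : ℕ} (σ p : Fin m → ℝ) (j : Fin m) (t : ℝ) :
    capMean σ (Function.update p j t) = t * capMean σ (Function.update p j 1)
      + (1 - t) * capMean σ (Function.update p j 0) := by
  simpa using capMean_split σ (Function.update p j t) j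

lemma update_mem_unit {m : ℕ} {p : Fin m → ℝ} (hp : ∀ j, 0 ≤ p j ∧ p j ≤ 1) (j : Fin m) {t : ℝ}
    (ht : 0 ≤ t ∧ t ≤ 1) : ∀ i, 0 ≤ Function.update p j t i ∧ Function.update p j t i ≤ 1 := by
  intro i
  rcases eq_or_ne i j with rfl | h
  · simpa using ht
  · simpa [h] using hp i

/-- The cap mean is affine in `p j`; at `p j = 1` it is at least `σ j`, and at `p j = 0` it is
nonnegative. -/
lemma mul_le_capMean {m : ℕ} (σ : Fin m → ℝ) {p : Fin m → ℝ}
    (hp : ∀ j, 0 ≤ p j ∧ p j ≤ 1) (j : Fin m) : p j * σ j ≤ capMean σ p := by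
  rw [capMean_split σ p j]
  have h1 := le_capMean σ (update_mem_unit hp j (t := 1) (by norm_num)) j (by simp)
  have h0 := capMean_nonneg σ (update_mem_unit hp j (t := 0) (by norm_num))
  have := mul_le_mul_of_nonneg_left h1 (hp j).1
  have := mul_nonneg (by linarith [(hp j).2] : 0 ≤ 1 - p j) h0
  linarith

/-- Chance that a business passes a finer fit test (of probability `fit'`), given the knowledge
obtained from a coarser fit test (of probability `fit`). -/
noncomputable def refinedChance {m : ℕ} (fit fit' : Fin m → ℝ) (κ : Knowledge m) (j : Fin m) : ℝ :=
  match κ j with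
  | none => fit' j
  | some true => fit' j / fit j
  | some false => 0

lemma refinedChance_update {m : ℕ} (fit fit' : Fin m → ℝ) (κ : Knowledge m) (j : Fin m) (b : Bool) :
    refinedChance fit fit' (Function.update κ j (some b))
      = Function.update (refinedChance fit fit' κ) j (if b then fit' j / fit j else 0) := by
  funext i
  by_cases h : i = j
  · subst h; cases b <;> simp [refinedChance]
  · simp [refinedChance, h]

lemma refinedChance_mem {m : ℕ} {fit fit' : Fin m → ℝ} (hf : ∀ j, 0 < fit j ∧ fit j ≤ 1)
    (hf' : ∀ j, 0 < fit' j ∧ fit' j ≤ fit j) (κ : Knowledge m) (j : Fin m) :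
    0 ≤ refinedChance fit fit' κ j ∧ refinedChance fit fit' κ j ≤ 1 := by
  unfold refinedChance
  split
  · exact ⟨(hf' j).1.le, (hf' j).2.trans (hf j).2⟩
  · exact ⟨div_nonneg (hf' j).1.le (hf j).1.le, (div_le_one (hf j).1).2 (hf' j).2⟩
  · norm_num

/-- A plan that uses only businesses in `S` and a coarse fit test earns at most the value of the
index rule for a finer fit test. -/
lemma Plan.Within.eu_le_capMean {m : ℕ} {c v : ℝ} {price fit qual fit' qual' σ : Fin m → ℝ}
    {S : Set (Fin m)} (hc : 0 ≤ c) (hP : ∀ j, 0 ≤ price j) (hf : ∀ j, 0 < fit j ∧ fit j ≤ 1)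
    (hf' : ∀ j, 0 < fit' j ∧ fit' j ≤ fit j) (hq : ∀ j, fit' j * qual' j = fit j * qual j)
    (hσ : ∀ j ∈ S, σ j = searchIndex c v (price j) (fit' j) (qual' j)) {p : Plan m}
    (hp : p.Within S) (κ : Knowledge m) (hκ : ∀ j, κ j = some true → j ∈ S) :
    p.eu c v price fit qual κ ≤ capMean σ (refinedChance fit fit' κ) + credit c fit κ := by
  have hterm : ∀ (κ : Knowledge m) (i : Fin m),
      0 ≤ (if κ i = some true then c / fit i else 0) := by
    intro κ i; split_ifs
    · exact div_nonneg hc (hf i).1.le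
    · exact le_rfl
  induction p generalizing κ with
  | halt o =>
    have h0 : 0 ≤ capMean σ (refinedChance fit fit' κ) + credit c fit κ :=
      add_nonneg (capMean_nonneg σ (refinedChance_mem hf hf' κ))
        (Finset.sum_nonneg fun i _ => hterm κ i)
    cases o with
    | none => simpa [Plan.eu] using h0
    | some j =>
      rcases hk : κ j with _ | _ | _
      · simpa [Plan.eu, hk] using h0
      · simp only [Plan.eu, hk]; linarith [hP j]
      · simp only [Plan.eu, hk]
        have h1 := mul_le_capMean σ (refinedChance_mem hf hf' κ) j
        have h2 : c / fit j ≤ credit c fit κ := by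
          have h5 : (if κ j = some true then c / fit j else 0) ≤ credit c fit κ :=
            Finset.single_le_sum (fun i _ => hterm κ i) (Finset.mem_univ j)
          rwa [if_pos hk] at h5
        have h3 : refinedChance fit fit' κ j = fit' j / fit j := by simp [refinedChance, hk]
        rw [h3, hσ j (hκ j hk), searchIndex] at h1
        have hfj := (hf j).1
        have hfj' := (hf' j).1
        -- The conditional chance of passing the finer test, times the finer index, is the coarse
        -- payoff except that the price is paid only upon passing the finer test. The term `c / fit
        -- j` is covered by the credit for a known fit.
        have h4 : fit' j / fit j * (v * qual' j - price j - c / fit' j)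
            = v * qual j - fit' j / fit j * price j - c / fit j := by
          field_simp
          linear_combination v * hq j
        have h6 : fit' j / fit j * price j ≤ price j :=
          mul_le_of_le_one_left (hP j) ((div_le_one hfj).2 (hf' j).2)
        linarith
  | inspect j a b iha ihb =>
    obtain ⟨hj, hpa, hpb⟩ := hp
    have ha := iha hpa (Function.update κ j (some true)) (by
      intro i hi
      rcases eq_or_ne i j with rfl | h
      · exact hj
      · exact hκ i (by simpa [h] using hi))
    have hb := ihb hpb (Function.update κ j (some false)) (by
      intro i hi
      rcases eq_or_ne i j with rfl | h
      · exact hj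
      · exact hκ i (by simpa [h] using hi))
    rw [refinedChance_update] at ha hb
    simp only [if_true, Bool.false_eq_true, if_false] at ha hb
    have hcr : ∀ b : Bool, credit c fit (Function.update κ j (some b))
        = (if b then c / fit j else 0) + ∑ i ∈ Finset.univ.erase j,
            (if κ i = some true then c / fit i else 0) := by
      intro b
      unfold credit
      rw [← Finset.add_sum_erase _ _ (Finset.mem_univ j)]
      congr 1
      · simp
      · refine Finset.sum_congr rfl fun i hi => ?_
        rw [Function.update_of_ne (Finset.ne_of_mem_erase hi)]
    have hcr0 : credit c fit κ = (if κ j = some true then c / fit j else 0)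
        + ∑ i ∈ Finset.univ.erase j, (if κ i = some true then c / fit i else 0) := by
      unfold credit
      rw [← Finset.add_sum_erase _ _ (Finset.mem_univ j)]
    rw [hcr true, capMean_affine] at ha
    rw [hcr false] at hb
    rw [capMean_split σ (refinedChance fit fit' κ) j, hcr0]
    simp only [if_true, Bool.false_eq_true, if_false] at ha hb
    simp only [Plan.eu]
    set A := a.eu c v price fit qual (Function.update κ j (some true))
    set B := b.eu c v price fit qual (Function.update κ j (some false))
    set C₁ := capMean σ (Function.update (refinedChance fit fit' κ) j 1)
    set C₀ := capMean σ (Function.update (refinedChance fit fit' κ) j 0)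
    set R := ∑ i ∈ Finset.univ.erase j, (if κ i = some true then c / fit i else 0)
    have hm := fitChance_mem hf κ j
    have e1 := mul_le_mul_of_nonneg_left ha hm.1
    have e2 := mul_le_mul_of_nonneg_left hb (by linarith [hm.2] : 0 ≤ 1 - fitChance fit κ j)
    have hfj := (hf j).1
    rcases hk : κ j with _ | _ | _
    · have hfc : fitChance fit κ j = fit j := by simp [fitChance, hk]
      have hrc : refinedChance fit fit' κ j = fit' j := by simp [refinedChance, hk]
      rw [hfc] at e1 e2 ⊢
      rw [hrc]
      simp only [reduceCtorEq, if_false]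
      -- The refined chance is a martingale under coarse inspection: it jumps to `fit' j / fit j`
      -- with probability `fit j` and to `0` otherwise. The expected new credit equals the
      -- inspection cost, so the potential is preserved. In the two remaining cases the repeated
      -- inspection teaches nothing and only costs `c`.
      have h7 : fit j * (fit' j / fit j * C₁ + (1 - fit' j / fit j) * C₀ + (c / fit j + R))
          = fit' j * C₁ + (fit j - fit' j) * C₀ + c + fit j * R := by
        field_simp
        ring
      linarith
    · have hfc : fitChance fit κ j = 0 := by simp [fitChance, hk]
      have hrc : refinedChance fit fit' κ j = 0 := by simp [refinedChance, hk]
      rw [hfc] at e1 e2 ⊢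
      rw [hrc]
      simp
      linarith
    · have hfc : fitChance fit κ j = 1 := by simp [fitChance, hk]
      have hrc : refinedChance fit fit' κ j = fit' j / fit j := by simp [refinedChance, hk]
      rw [hfc] at e1 e2 ⊢
      rw [hrc]
      simp
      linarith

lemma indexPlan_within {m : ℕ} {S : Set (Fin m)} {l : List (Fin m)} (h : ∀ j ∈ l, j ∈ S) :
    (indexPlan l).Within S := by
  induction l with
  | nil => trivial
  | cons j l ih => exact ⟨h j (by simp), trivial, ih fun i hi => h i (by simp [hi])⟩

lemma eu_indexPlan_congr_price {m : ℕ} {c v : ℝ} {price price' fit qual : Fin m → ℝ}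
    {l : List (Fin m)} (h : ∀ j ∈ l, price j = price' j) (κ : Knowledge m) :
    (indexPlan l).eu c v price fit qual κ = (indexPlan l).eu c v price' fit qual κ := by
  induction l generalizing κ with
  | nil => rfl
  | cons j l ih =>
    simp only [indexPlan, Plan.eu, Function.update_self]
    rw [ih (fun i hi => h i (by simp [hi])), h j (by simp)]

lemma exists_isIndexOrder {m : ℕ} (idx : Fin m → ℝ) : ∃ l, IsIndexOrder idx l := by
  classical
  let L := (Finset.univ.filter (fun j => 0 < idx j)).toList
  have hperm := List.perm_insertionSort (fun i j => idx j ≤ idx i) L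
  have : Std.Total (fun i j : Fin m => idx j ≤ idx i) := ⟨fun i j => le_total _ _⟩
  have : IsTrans (Fin m) (fun i j : Fin m => idx j ≤ idx i) := ⟨fun _ _ _ h1 h2 => h2.trans h1⟩
  refine ⟨L.insertionSort (fun i j => idx j ≤ idx i), hperm.nodup_iff.2 (Finset.nodup_toList _),
    fun j => ?_, List.pairwise_insertionSort _ _⟩
  rw [hperm.mem_iff]
  simp [L]

/-- The search index, with prices off `S` raised so much that the index is nonpositive there. -/
noncomputable def restrictedIndex {m : ℕ} (S : Set (Fin m)) (c v : ℝ) (price fit qual : Fin m → ℝ)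
    (j : Fin m) : ℝ :=
  open Classical in
  searchIndex c v (if j ∈ S then price j else price j + |v|) (fit j) (qual j)

/-- Raising prices off `S` by `|v|` makes every index there nonpositive, because qualities are at
most one. The unrestricted index plan of the modified market therefore stays in `S`. -/
lemma exists_plan_eu_eq_capMean {m : ℕ} {c : ℝ} (v : ℝ) {price fit qual : Fin m → ℝ}
    (S : Set (Fin m)) (hc : 0 ≤ c) (hP : ∀ j, 0 ≤ price j) (hf : ∀ j, 0 < fit j ∧ fit j ≤ 1)
    (hq : ∀ j, 0 ≤ qual j ∧ qual j ≤ 1) :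
    ∃ p : Plan m, p.Within S ∧ p.eu c v price fit qual (Knowledge.init m)
      = capMean (restrictedIndex S c v price fit qual) fit := by
  classical
  obtain ⟨l, hl⟩ := exists_isIndexOrder (restrictedIndex S c v price fit qual)
  have hlS : ∀ j ∈ l, j ∈ S := by
    intro j hj
    by_contra hjS
    have h := (hl.2.1 j).1 hj
    simp only [restrictedIndex, if_neg hjS, searchIndex] at h
    have h1 : v * qual j ≤ |v| := by
      calc v * qual j ≤ |v| * qual j := mul_le_mul_of_nonneg_right (le_abs_self v) (hq j).1
        _ ≤ |v| := mul_le_of_le_one_right (abs_nonneg v) (hq j).2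
    linarith [hP j, div_nonneg hc (hf j).1.le]
  refine ⟨indexPlan l, indexPlan_within hlS, ?_⟩
  -- The plan pays only prices of businesses on its list, all in `S`, so the raised prices may be
  -- substituted.
  rw [eu_indexPlan_congr_price
    (price' := fun j => if j ∈ S then price j else price j + |v|)
    (fun j hj => by simp [hlS j hj])]
  exact eu_indexPlan c v _ fit qual hf l (Knowledge.init m) hl.1 (fun _ _ => rfl)
    (fun j hj => Or.inl (not_lt.1 fun h => hj ((hl.2.1 j).2 h))) (fun j hj => (hl.2.1 j).1 hj)
    hl.2.2

/-- Initially there is no credit and the refined chance is `fit'`. Taking the finer test equal to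
the coarse one gives the upper bound matching `exists_plan_eu_eq_capMean`; a strictly finer test
gives the comparison between degrees. -/
lemma Plan.Within.eu_init_le {m : ℕ} {c v : ℝ} {price fit qual fit' qual' : Fin m → ℝ}
    {S : Set (Fin m)} (hc : 0 ≤ c) (hP : ∀ j, 0 ≤ price j) (hf : ∀ j, 0 < fit j ∧ fit j ≤ 1)
    (hf' : ∀ j, 0 < fit' j ∧ fit' j ≤ fit j) (hq : ∀ j, fit' j * qual' j = fit j * qual j)
    {p : Plan m} (hp : p.Within S) :
    p.eu c v price fit qual (Knowledge.init m)
      ≤ capMean (restrictedIndex S c v price fit' qual') fit' := by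
  refine (hp.eu_le_capMean hc hP hf hf' hq (σ := restrictedIndex S c v price fit' qual')
    (fun j hj => by simp [restrictedIndex, hj]) (Knowledge.init m)
    (fun j hj => by simp [Knowledge.init] at hj)).trans (le_of_eq ?_)
  have : refinedChance fit fit' (Knowledge.init m) = fit' := rfl
  simp [credit, Knowledge.init, this]

lemma Plan.Within.mono {m : ℕ} {S T : Set (Fin m)} (h : S ⊆ T) {p : Plan m} (hp : p.Within S) :
    p.Within T := by
  induction p with
  | halt => trivial
  | inspect j a b iha ihb => exact ⟨h hp.1, iha hp.2.1, ihb hp.2.2⟩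

/-! ### Fit probability and quality -/

lemma fitProb_eq_prod {r : ℕ} (k : ℕ) (x : Fin r → unitInterval) :
    fitProb k x = ∏ l : Fin r, if (l : ℕ) < k then (x l : ℝ) else 1 := by
  rw [fitProb, Finset.prod_filter]

lemma quality_eq_prod {r : ℕ} (k : ℕ) (x : Fin r → unitInterval) :
    quality k x = ∏ l : Fin r, if k ≤ (l : ℕ) then (x l : ℝ) else 1 := by
  rw [quality, Finset.prod_filter]

/-- The product is free of `k`: the degree only moves screens between the two factors. This is the
quantity that the two markets share. -/
lemma fitProb_mul_quality {r : ℕ} (k : ℕ) (x : Fin r → unitInterval) :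
    fitProb k x * quality k x = ∏ l, (x l : ℝ) := by
  rw [fitProb_eq_prod, quality_eq_prod, ← Finset.prod_mul_distrib]
  refine Finset.prod_congr rfl fun l _ => ?_
  by_cases h : (l : ℕ) < k
  · simp [h]
  · simp [h, not_lt.1 h]

lemma fitProb_anti {r k k' : ℕ} (h : k ≤ k') (x : Fin r → unitInterval) :
    fitProb k' x ≤ fitProb k x := by
  rw [fitProb_eq_prod, fitProb_eq_prod]
  refine Finset.prod_le_prod (fun l _ => ?_) (fun l _ => ?_)
  · split_ifs
    · exact (x l).2.1
    · exact zero_le_one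
  · by_cases h1 : (l : ℕ) < k
    · simp [h1, h1.trans_le h]
    · simp only [h1, if_false]
      split_ifs
      · exact (x l).2.2
      · exact le_rfl

lemma fitProb_le_one {r : ℕ} (k : ℕ) (x : Fin r → unitInterval) : fitProb k x ≤ 1 :=
  Finset.prod_le_one (fun l _ => (x l).2.1) (fun l _ => (x l).2.2)

lemma fitProb_nonneg {r : ℕ} (k : ℕ) (x : Fin r → unitInterval) : 0 ≤ fitProb k x :=
  Finset.prod_nonneg (fun l _ => (x l).2.1)

lemma fitProb_pos {r : ℕ} (k : ℕ) {x : Fin r → unitInterval} (hx : ∀ l, 0 < (x l : ℝ)) :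
    0 < fitProb k x :=
  Finset.prod_pos (fun l _ => hx l)

lemma quality_le_one {r : ℕ} (k : ℕ) (x : Fin r → unitInterval) : quality k x ≤ 1 :=
  Finset.prod_le_one (fun l _ => (x l).2.1) (fun l _ => (x l).2.2)

lemma quality_nonneg {r : ℕ} (k : ℕ) (x : Fin r → unitInterval) : 0 ≤ quality k x :=
  Finset.prod_nonneg (fun l _ => (x l).2.1)

/-! ### Integrability of the cap mean and comparison of optimal utilities -/

lemma capMean_abs_le {m : ℕ} {σ p : Fin m → ℝ} (hp : ∀ j, 0 ≤ p j ∧ p j ≤ 1) {b : ℝ} (hb : 0 ≤ b)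
    (hσ : ∀ j, σ j ≤ b) : |capMean σ p| ≤ b := by
  rw [abs_of_nonneg (capMean_nonneg σ hp)]
  have h1 : b = ∑ F : Fin m → Bool, (∏ i, wt (F i) (p i)) * b := by
    rw [← Finset.sum_mul, wt_sum, one_mul]
  rw [h1]
  refine Finset.sum_le_sum fun F _ => mul_le_mul_of_nonneg_left ?_ (wt_nonneg hp F)
  have : cap σ F ≤ b.toNNReal := Finset.sup_le fun j _ => Real.toNNReal_le_toNNReal (hσ j)
  calc (cap σ F : ℝ) ≤ (b.toNNReal : ℝ) := NNReal.coe_le_coe.2 this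
    _ = b := Real.coe_toNNReal b hb

lemma measurable_capMean {m : ℕ} {σ : ℝ → Fin m → ℝ} (hσ : ∀ j, Measurable fun v => σ v j)
    (p : Fin m → ℝ) : Measurable fun v => capMean (σ v) p := by
  unfold capMean
  refine Finset.measurable_sum _ fun F _ => Measurable.const_mul ?_ _
  refine measurable_coe_nnreal_real.comp ?_
  have : ∀ s : Finset (Fin m), Measurable fun v => s.sup fun j => (σ v j).toNNReal := by
    intro s
    classical
    induction s using Finset.induction_on with
    | empty => simp
    | insert a s _ ih =>
      simp only [Finset.sup_insert]
      exact (hσ a).real_toNNReal.sup ih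
  exact this _

namespace ScreenMarket

variable {m r : ℕ}

/-- More screens revealed by an inspection and more available businesses make a knowledgeable
consumer better off. -/
theorem optimalUtility_mono (E : ScreenMarket m r) {k k' : ℕ} (hk : k ≤ k') {S T : Set (Fin m)}
    (hST : S ⊆ T) : E.optimalUtility k S ≤ E.optimalUtility k' T := by
  classical
  set f := fun j => fitProb k (E.param j) with hfdef
  set q := fun j => quality k (E.param j) with hqdef
  set f' := fun j => fitProb k' (E.param j) with hfdef'
  set q' := fun j => quality k' (E.param j) with hqdef'
  have hf : ∀ j, 0 < f j ∧ f j ≤ 1 := fun j => ⟨fitProb_pos k (E.param_pos j), fitProb_le_one _ _⟩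
  have hf' : ∀ j, 0 < f' j ∧ f' j ≤ 1 :=
    fun j => ⟨fitProb_pos k' (E.param_pos j), fitProb_le_one _ _⟩
  have hff : ∀ j, 0 < f' j ∧ f' j ≤ f j := fun j => ⟨(hf' j).1, fitProb_anti hk _⟩
  have hqq : ∀ j, f' j * q' j = f j * q j := fun j => by
    simp only [hfdef, hfdef', hqdef, hqdef', fitProb_mul_quality]
  have hq' : ∀ j, 0 ≤ q' j ∧ q' j ≤ 1 := fun j => ⟨quality_nonneg _ _, quality_le_one _ _⟩
  have hP := E.price_nonneg
  have hc := E.cost_nonneg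
  have hne : ∀ U : Set (Fin m), Nonempty {p : Plan m // p.Within U} :=
    fun U => ⟨⟨.halt none, trivial⟩⟩
  -- The supremum on the larger side is computed in closed form, which is what makes its
  -- measurability in `v` accessible.
  have hT : ∀ v, (⨆ p : {p : Plan m // p.Within T}, p.1.eu E.cost v E.price f' q'
      (Knowledge.init m)) = capMean (restrictedIndex T E.cost v E.price f' q') f' := by
    intro v
    obtain ⟨p, hp, he⟩ := exists_plan_eu_eq_capMean v T hc hP hf' hq'
    refine le_antisymm (ciSup_le fun p => p.2.eu_init_le hc hP hf'
      (fun j => ⟨(hf' j).1, le_rfl⟩) (fun _ => rfl)) ?_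
    rw [← he]
    exact le_ciSup (f := fun p : {p : Plan m // p.Within T} =>
      p.1.eu E.cost v E.price f' q' (Knowledge.init m))
      ⟨_, by
        rintro _ ⟨p, rfl⟩
        exact p.2.eu_init_le hc hP hf' (fun j => ⟨(hf' j).1, le_rfl⟩) (fun _ => rfl)⟩ ⟨p, hp⟩
  unfold optimalUtility
  -- Only the larger integrand must be integrable. The smaller one is nonnegative, as halting at
  -- once earns zero, so its measurability is never needed.
  refine integral_mono_of_nonneg (Eventually.of_forall fun v => ?_) ?_
    (Eventually.of_forall fun v => ?_)
  · exact le_ciSup_of_le (f := fun p : {p : Plan m // p.Within S} =>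
      p.1.eu E.cost v E.price f q (Knowledge.init m)) ⟨_, by
        rintro _ ⟨p, rfl⟩
        exact p.2.eu_init_le hc hP hf hff hqq⟩ ⟨.halt none, trivial⟩ le_rfl
  · refine Integrable.congr (f := fun v => capMean (restrictedIndex T E.cost v E.price f' q') f')
      ?_ (Eventually.of_forall fun v => (hT v).symm)
    obtain ⟨b, hb⟩ := E.bounded_valueLaw
    have hmeas : Measurable fun v => capMean (restrictedIndex T E.cost v E.price f' q') f' := by
      refine measurable_capMean (fun j => ?_) f'
      unfold restrictedIndex searchIndex
      by_cases hj : j ∈ T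
      · simp only [hj, if_true]; fun_prop
      · simp only [hj, if_false]; fun_prop
    refine Integrable.of_bound (C := |b|) hmeas.aestronglyMeasurable ?_
    filter_upwards [hb] with v hv
    rw [Real.norm_eq_abs]
    refine capMean_abs_le (fun j => ⟨(hf' j).1.le, (hf' j).2⟩) (abs_nonneg b) fun j => ?_
    unfold restrictedIndex searchIndex
    have h1 : v * q' j ≤ v := mul_le_of_le_one_right hv.1 (hq' j).2
    have h2 : 0 ≤ E.cost / f' j := div_nonneg hc (hf' j).1.le
    have h3 : (0 : ℝ) ≤ if j ∈ T then E.price j else E.price j + |v| := by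
      split_ifs
      · exact hP j
      · exact add_nonneg (hP j) (abs_nonneg v)
    linarith [le_abs_self b, hv.2]
  · refine ciSup_le fun p => ?_
    have h1 := (p.2.mono hST).eu_init_le (c := E.cost) (v := v) (price := E.price) hc hP hf hff hqq
    exact h1.trans_eq (hT v).symm

end ScreenMarket
/-! ### The outcome of an inspection -/

/-- The first failed screen in the whole sequence; `⊤` if there is none. -/
def firstFailed {r : ℕ} (f : Fin r → Bool) : WithTop (Fin r) := firstFail 0 r f

lemma fitOf_iff {r k : ℕ} {f : Fin r → Bool} :
    fitOf k f = true ↔ ∀ l : Fin r, (l : ℕ) < k → f l = true := by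
  simp [fitOf]

lemma firstFail_eq_top {r lo hi : ℕ} {f : Fin r → Bool} :
    firstFail lo hi f = ⊤ ↔ ∀ l : Fin r, lo ≤ (l : ℕ) → (l : ℕ) < hi → f l = true := by
  simp [firstFail, Finset.min_eq_top, Finset.filter_eq_empty_iff]

lemma le_firstFailed {r : ℕ} {f : Fin r → Bool} {l : Fin r} :
    (l : WithTop (Fin r)) ≤ firstFailed f ↔ fitOf l f = true := by
  rw [fitOf_iff, firstFailed, firstFail, Finset.min, Finset.le_inf_iff]
  simp only [Finset.mem_filter, Finset.mem_univ, true_and, zero_le, Fin.is_lt,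
    WithTop.coe_le_coe]
  constructor
  · intro h i hi
    by_contra hf
    exact absurd (h i (by simpa using hf)) (by simpa using hi)
  · intro h i hf
    by_contra hi
    rw [h i (by simpa using hi)] at hf
    exact absurd hf (by simp)

/-- Screens are numbered from zero, so reaching screen `l` is fit at degree `l` and passing it is
fit at degree `l + 1`. -/
lemma lt_firstFailed {r : ℕ} {f : Fin r → Bool} {l : Fin r} :
    (l : WithTop (Fin r)) < firstFailed f ↔ fitOf (l + 1) f = true := by
  rw [fitOf_iff, firstFailed, firstFail, Finset.min, Finset.lt_inf_iff (WithTop.coe_lt_top l)]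
  simp only [Finset.mem_filter, Finset.mem_univ, true_and, zero_le, Fin.is_lt,
    WithTop.coe_lt_coe]
  constructor
  · intro h i hi
    by_contra hf
    have := h i (by simpa using hf)
    rw [Fin.lt_def] at this
    omega
  · intro h i hf
    by_contra hi
    rw [Fin.lt_def] at hi
    rw [h i (by omega)] at hf
    exact absurd hf (by simp)

lemma firstFailed_eq_top {r : ℕ} {f : Fin r → Bool} : firstFailed f = ⊤ ↔ fitOf r f = true := by
  rw [firstFailed, firstFail_eq_top, fitOf_iff]
  simp

/-- Fit at any degree only asks whether the first failure comes late enough, so the course of a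
search depends on the screens through `firstFailed` alone. -/
lemma fitOf_eq_of_firstFailed_eq {r : ℕ} (k : ℕ) {f g : Fin r → Bool}
    (h : firstFailed f = firstFailed g) : fitOf k f = fitOf k g := by
  have key : ∀ {f g : Fin r → Bool}, firstFailed f = firstFailed g → fitOf k f = true →
      fitOf k g = true := by
    intro f g h hf
    rw [fitOf_iff] at hf ⊢
    intro l hl
    have : (l : WithTop (Fin r)) < firstFailed f :=
      lt_firstFailed.2 (fitOf_iff.2 fun i hi => hf i (by omega))
    rw [h, lt_firstFailed, fitOf_iff] at this
    exact this l (by omega)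
  rw [Bool.eq_iff_iff]
  exact ⟨key h, key h.symm⟩

lemma firstFail_zero_of_fitOf {r k : ℕ} {f : Fin r → Bool} (h : fitOf k f = true) :
    firstFail 0 k f = ⊤ :=
  firstFail_eq_top.2 fun l _ hl => fitOf_iff.1 h l hl

lemma firstFail_rest_of_fitOf {r k : ℕ} {f : Fin r → Bool} (h : fitOf k f = true) :
    firstFail k r f = firstFailed f := by
  unfold firstFailed firstFail
  congr 1
  ext l
  simp only [Finset.mem_filter, Finset.mem_univ, true_and, zero_le]
  constructor
  · exact fun hl => hl.2
  · refine fun hl => ⟨?_, hl⟩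
    by_contra hlk
    rw [fitOf_iff.1 h l (by omega)] at hl
    exact absurd hl.2 (by simp)

/-- A misfit fails one of the first `k` screens, and any later failure is irrelevant to the minimum.
Together with `firstFail_rest_of_fitOf` this shows that the record yields the overall first failure
on either side of the degree. -/
lemma firstFail_zero_of_not_fitOf {r k : ℕ} {f : Fin r → Bool} (h : fitOf k f = false) :
    firstFail 0 k f = firstFailed f ∧ firstFail 0 k f ≠ ⊤ := by
  have h0 : firstFail 0 k f ≠ ⊤ := by
    rw [Ne, firstFail_eq_top]
    intro h1
    have : fitOf k f = true := fitOf_iff.2 fun l hl => h1 l (Nat.zero_le _) hl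
    simp [h] at this
  refine ⟨?_, h0⟩
  unfold firstFailed
  refine le_antisymm ?_ (Finset.min_mono fun l hl => by simp_all)
  refine Finset.le_min fun l hl => ?_
  simp only [Finset.mem_filter, Finset.mem_univ, true_and] at hl
  by_cases hlk : (l : ℕ) < k
  · exact Finset.min_le (by simp [hlk, hl.2.2])
  · obtain ⟨i, hi⟩ := WithTop.ne_top_iff_exists.1 h0
    have hmem := Finset.mem_of_min hi.symm
    simp only [Finset.mem_filter, Finset.mem_univ, true_and] at hmem
    rw [← hi, WithTop.coe_le_coe, Fin.le_def]
    omega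

/-- The first failed screen of business `j` in the whole screen sequence, as revealed by the
feedback of a round; `none` if `j` was not inspected. -/
def Feedback.outcome {m r : ℕ} (fb : Feedback m r) (j : Fin m) : Option (WithTop (Fin r)) :=
  (fb.inspection j).map fun z =>
    if z = ⊤ then fb.transaction.elim ⊤ Prod.snd else z

/-! ### Carrying out an index plan -/

lemma run_indexPlan_cons {m : ℕ} (F : Fin m → Bool) (j : Fin m) (l : List (Fin m))
    (κ : Knowledge m) : (indexPlan (j :: l)).run F κ =
      if F j then (Function.update κ j (some true), some j)
      else (indexPlan l).run F (Function.update κ j (some false)) := by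
  simp only [indexPlan, Plan.run]
  split_ifs <;> simp [Option.filter]

/-- The condition on `κ` is the invariant of a search still in progress: everything inspected so far
was a misfit. It forces the transaction to be with the one known fit. The last clause serves a
consumer who meets no fit and exhausts the list. -/
lemma run_indexPlan_spec {m : ℕ} (F : Fin m → Bool) (l : List (Fin m)) (κ : Knowledge m)
    (hκ : ∀ j, κ j = none ∨ (κ j = some false ∧ F j = false)) :
    (∀ j, ((indexPlan l).run F κ).1 j = none ∨ ((indexPlan l).run F κ).1 j = some (F j)) ∧
    (∀ j, ((indexPlan l).run F κ).2 = some j ↔ ((indexPlan l).run F κ).1 j = some true) ∧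
    (∀ j, ((indexPlan l).run F κ).1 j ≠ none → j ∈ l ∨ κ j ≠ none) ∧
    (∀ j, κ j ≠ none → ((indexPlan l).run F κ).1 j ≠ none) ∧
    ((∀ j ∈ l, F j = false) → ∀ j ∈ l, ((indexPlan l).run F κ).1 j ≠ none) := by
  induction l generalizing κ with
  | nil =>
    refine ⟨fun j => ?_, fun j => ?_, fun j h => Or.inr h, fun j h => h, by simp⟩
    · rcases hκ j with h | h
      · exact Or.inl h
      · right; simpa [indexPlan, Plan.run, h.2] using h.1
    · rcases hκ j with h | h <;> simp [indexPlan, Plan.run, h]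
  | cons i l ih =>
    rw [run_indexPlan_cons]
    by_cases hi : F i = true
    · simp only [hi, if_true]
      refine ⟨fun j => ?_, fun j => ?_, fun j h => ?_, fun j h => ?_, fun h => ?_⟩
      · rcases eq_or_ne j i with rfl | hji
        · right; simp [hi]
        · rcases hκ j with h | h <;> simp [hji, h]
      · rcases eq_or_ne j i with rfl | hji
        · simp
        · rcases hκ j with h | h <;> simp [hji, hji.symm, h]
      · rcases eq_or_ne j i with rfl | hji
        · simp
        · right; simpa [hji] using h
      · rcases eq_or_ne j i with rfl | hji
        · simp
        · simpa [hji] using h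
      · have := h i (by simp)
        simp [hi] at this
    · simp only [hi, if_false, Bool.false_eq_true]
      have hi' : F i = false := by simpa using hi
      obtain ⟨h1, h2, h3, h4, h5⟩ := ih (Function.update κ i (some false)) (by
        intro j
        rcases eq_or_ne j i with rfl | hji
        · right; simp [hi']
        · simpa [hji] using hκ j)
      refine ⟨h1, h2, fun j h => ?_, fun j h => ?_, fun h j hj => ?_⟩
      · rcases eq_or_ne j i with rfl | hji
        · simp
        · simpa [hji] using h3 j h
      · refine h4 j ?_
        rcases eq_or_ne j i with rfl | hji
        · simp
        · simpa [hji] using h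
      · rcases List.mem_cons.1 hj with rfl | hj
        · exact h4 j (by simp)
        · exact h5 (fun j hj => h j (by simp [hj])) j hj

lemma run_indexPlan_congr {m : ℕ} {F F' : Fin m → Bool} (l : List (Fin m)) (κ : Knowledge m)
    (h : ∀ j ∈ l, ((indexPlan l).run F κ).1 j ≠ none → F j = F' j)
    (hκ : ∀ j, κ j = none ∨ (κ j = some false ∧ F j = false)) :
    (indexPlan l).run F' κ = (indexPlan l).run F κ := by
  induction l generalizing κ with
  | nil => rfl
  | cons i l ih =>
    have hin : ((indexPlan (i :: l)).run F κ).1 i ≠ none := by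
      rw [run_indexPlan_cons]
      split_ifs with hi
      · simp
      · refine (run_indexPlan_spec F l _ ?_).2.2.2.1 i (by simp)
        intro j
        rcases eq_or_ne j i with rfl | hji
        · right; simpa using hi
        · simpa [hji] using hκ j
    have hFi : F i = F' i := h i (by simp) hin
    rw [run_indexPlan_cons] at h ⊢
    rw [run_indexPlan_cons, ← hFi]
    split_ifs with hi
    · rfl
    · refine ih _ (fun j hj hne => h j (by simp [hj]) (by rwa [if_neg hi])) ?_
      intro j
      rcases eq_or_ne j i with rfl | hji
      · right; simpa using hi
      · simpa [hji] using hκ j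

/-! ### The public feedback of one round -/

section Round

variable {m r : ℕ} (k : ℕ) (l : List (Fin m)) (f : Fin m → Fin r → Bool)

lemma knowledge_init_spec (F : Fin m → Bool) (j : Fin m) :
    Knowledge.init m j = none ∨ (Knowledge.init m j = some false ∧ F j = false) := Or.inl rfl

/-- For a misfit the inspection record shows the first failure; for a fit the search ends with a
transaction there, whose record shows it. Hence the degree affects who is inspected, but not what an
inspection reveals. -/
lemma outcome_roundFeedback_eq (j : Fin m) :
    (roundFeedback k (indexPlan l) f).outcome j =
      (((indexPlan l).run (fun j => fitOf k (f j)) (Knowledge.init m)).1 j).map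
        fun _ => firstFailed (f j) := by
  obtain ⟨h1, h2, -, -⟩ := run_indexPlan_spec (fun j => fitOf k (f j)) l (Knowledge.init m)
    (knowledge_init_spec _)
  unfold Feedback.outcome roundFeedback
  simp only [Option.map_map]
  rcases h1 j with h | h
  · simp [h]
  · simp only [h, Option.map_some, Function.comp, Option.some.injEq]
    cases hF : fitOf k (f j)
    · have := firstFail_zero_of_not_fitOf hF
      rw [if_neg this.2, this.1]
    · rw [if_pos (firstFail_zero_of_fitOf hF), (h2 j).2 (by rw [h, hF])]
      simp [firstFail_rest_of_fitOf hF]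

lemma outcome_roundFeedback (j : Fin m) :
    (roundFeedback k (indexPlan l) f).outcome j = none ∨
      (roundFeedback k (indexPlan l) f).outcome j = some (firstFailed (f j)) := by
  rw [outcome_roundFeedback_eq]
  rcases h : ((indexPlan l).run (fun j => fitOf k (f j)) (Knowledge.init m)).1 j with _ | b <;> simp

lemma mem_of_outcome_ne_none {j : Fin m}
    (h : (roundFeedback k (indexPlan l) f).outcome j ≠ none) : j ∈ l := by
  rw [outcome_roundFeedback_eq] at h
  have := (run_indexPlan_spec (fun j => fitOf k (f j)) l (Knowledge.init m)
    (knowledge_init_spec _)).2.2.1 j (by simpa using h)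
  simpa [Knowledge.init] using this

lemma outcome_ne_none_of_no_fit (hf : ∀ j, fitOf k (f j) = false) {j : Fin m} (hj : j ∈ l) :
    (roundFeedback k (indexPlan l) f).outcome j ≠ none := by
  rw [outcome_roundFeedback_eq]
  have := (run_indexPlan_spec (fun j => fitOf k (f j)) l (Knowledge.init m)
    (knowledge_init_spec _)).2.2.2.2 (fun j _ => hf j) j hj
  simpa using this

variable {k l f}

/-- The search looks only at inspected businesses and only at their fits, and each entry of the
record is a function of the first failed screen. -/
lemma roundFeedback_congr {f' : Fin m → Fin r → Bool}
    (h : ∀ j, (roundFeedback k (indexPlan l) f).outcome j ≠ none →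
      firstFailed (f j) = firstFailed (f' j)) :
    roundFeedback k (indexPlan l) f' = roundFeedback k (indexPlan l) f := by
  simp only [outcome_roundFeedback_eq, ne_eq, Option.map_eq_none_iff] at h
  have hrun := run_indexPlan_congr (F := fun j => fitOf k (f j)) (F' := fun j => fitOf k (f' j)) l
    (Knowledge.init m) (fun j _ hj => fitOf_eq_of_firstFailed_eq k (h j hj)) (knowledge_init_spec _)
  obtain ⟨h1, h2, -, -⟩ := run_indexPlan_spec (fun j => fitOf k (f j)) l (Knowledge.init m)
    (knowledge_init_spec _)
  unfold roundFeedback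
  simp only [hrun, Feedback.mk.injEq]
  constructor
  · funext j
    rcases hj : ((indexPlan l).run (fun j => fitOf k (f j)) (Knowledge.init m)).1 j with _ | b
    · simp
    · have e := h j (by simp [hj])
      simp only [Option.map_some, Option.some.injEq]
      cases hF : fitOf k (f j)
      · rw [(firstFail_zero_of_not_fitOf hF).1, (firstFail_zero_of_not_fitOf
          ((fitOf_eq_of_firstFailed_eq k e).symm.trans hF)).1, e]
      · rw [firstFail_zero_of_fitOf hF, firstFail_zero_of_fitOf
          ((fitOf_eq_of_firstFailed_eq k e).symm.trans hF)]
  · rcases ht : ((indexPlan l).run (fun j => fitOf k (f j)) (Knowledge.init m)).2 with _ | j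
    · simp
    · have hj := (h2 j).1 ht
      have e := h j (by simp [hj])
      have hF : fitOf k (f j) = true := by
        rcases h1 j with h' | h'
        · simp [hj] at h'
        · rw [hj] at h'; simpa using h'.symm
      simp [firstFail_rest_of_fitOf hF, firstFail_rest_of_fitOf
          ((fitOf_eq_of_firstFailed_eq k e).symm.trans hF), e]

/-- The feedback of a round is determined by the plan's consistency with it and the outcomes of the
inspected businesses. -/
lemma roundFeedback_eq_iff {fb : Feedback m r} : roundFeedback k (indexPlan l) f = fb ↔
    (∃ f₀, roundFeedback k (indexPlan l) f₀ = fb) ∧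
      ∀ j o, fb.outcome j = some o → firstFailed (f j) = o := by
  constructor
  · rintro rfl
    refine ⟨⟨f, rfl⟩, fun j o ho => ?_⟩
    rcases outcome_roundFeedback k l f j with h | h
    · simp [h] at ho
    · simpa [h] using ho
  · rintro ⟨⟨f₀, rfl⟩, h⟩
    refine roundFeedback_congr fun j hj => ?_
    rcases outcome_roundFeedback k l f₀ j with h' | h'
    · exact absurd h' hj
    · exact (h j _ h').symm

end Round
/-! ### Histories generated from consumers' values and from stacks of screens -/

instance {m r : ℕ} : Finite (Feedback m r) :=
  Finite.of_injective (fun fb : Feedback m r => (fb.inspection, fb.transaction)) (by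
    rintro ⟨a, b⟩ ⟨a', b'⟩ h
    simpa using h)

/-- The outcomes of the successive inspections of business `j`. -/
def outs {m r : ℕ} (j : Fin m) (h : List (Feedback m r)) : List (WithTop (Fin r)) :=
  h.filterMap fun fb => fb.outcome j

lemma outs_concat_none {m r : ℕ} {j : Fin m} {h : List (Feedback m r)} {fb : Feedback m r}
    (hfb : fb.outcome j = none) : outs j (h ++ [fb]) = outs j h := by
  simp [outs, hfb]

lemma outs_concat_some {m r : ℕ} {j : Fin m} {h : List (Feedback m r)} {fb : Feedback m r}
    {o : WithTop (Fin r)} (hfb : fb.outcome j = some o) :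
    outs j (h ++ [fb]) = outs j h ++ [o] := by
  simp [outs, hfb]

/-- A reader says, for every public history and every business, the screens of which consumer in
the stream the current consumer faces at that business. -/
abbrev Reader (m r : ℕ) : Type := List (Feedback m r) → Fin m → ℕ

/-- Every consumer faces her own screens. -/
def streamReader (m r : ℕ) : Reader m r := fun h _ => h.length

/-- The screens of each business form a stack, which is used up by its inspections. -/
def stackReader (m r : ℕ) : Reader m r := fun h j => (outs j h).length

/-- No screens are inspected twice. -/
structure IsFresh {m r : ℕ} (ρ : Reader m r) : Prop where
  le_length : ∀ h j, ρ h j ≤ h.length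
  mono : ∀ h fb j, ρ h j ≤ ρ (h ++ [fb]) j
  lt : ∀ h fb j, fb.outcome j ≠ none → ρ h j < ρ (h ++ [fb]) j

lemma isFresh_streamReader (m r : ℕ) : IsFresh (streamReader m r) where
  le_length _ _ := le_rfl
  mono h fb j := by simp [streamReader]
  lt h fb j _ := by simp [streamReader]

lemma isFresh_stackReader (m r : ℕ) : IsFresh (stackReader m r) where
  le_length h j := List.length_filterMap_le _ _
  mono h fb j := by simp [stackReader, outs]
  lt h fb j hfb := by
    obtain ⟨o, ho⟩ := Option.ne_none_iff_exists'.1 hfb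
    simp [stackReader, outs_concat_some ho]

/-- The public history after `n` rounds if screens are read according to `ρ`. -/
def processUpTo {m r : ℕ} (k : ℕ) (s : Strategy m r) (ρ : Reader m r) (ω : ℕ → Consumer m r) :
    ℕ → List (Feedback m r)
  | 0 => []
  | n + 1 => processUpTo k s ρ ω n ++ [roundFeedback k (s (processUpTo k s ρ ω n) (ω n).1)
      fun j => (ω (ρ (processUpTo k s ρ ω n) j)).2 j]

/-- The infinite public history if screens are read according to `ρ`. -/
def process {m r : ℕ} (k : ℕ) (s : Strategy m r) (ρ : Reader m r) (ω : ℕ → Consumer m r) :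
    ℕ → Feedback m r :=
  fun n => roundFeedback k (s (processUpTo k s ρ ω n) (ω n).1)
    fun j => (ω (ρ (processUpTo k s ρ ω n) j)).2 j

section Histories

variable {m r : ℕ} (k : ℕ) (s : Strategy m r) (ρ : Reader m r) (ω : ℕ → Consumer m r)

lemma processUpTo_succ (n : ℕ) :
    processUpTo k s ρ ω (n + 1) = processUpTo k s ρ ω n ++ [process k s ρ ω n] := rfl

@[simp] lemma length_processUpTo (n : ℕ) : (processUpTo k s ρ ω n).length = n := by
  induction n with
  | zero => rfl
  | succ n ih => simp [processUpTo_succ, ih]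

lemma historyPrefix_succ (H : ℕ → Feedback m r) (n : ℕ) :
    historyPrefix H (n + 1) = historyPrefix H n ++ [H n] := by
  simp [historyPrefix, List.range_succ]

lemma historyPrefix_process (n : ℕ) :
    historyPrefix (process k s ρ ω) n = processUpTo k s ρ ω n := by
  induction n with
  | zero => rfl
  | succ n ih => rw [historyPrefix_succ, ih, processUpTo_succ]

lemma historyUpTo_eq_processUpTo (n : ℕ) :
    historyUpTo k s ω n = processUpTo k s (streamReader m r) ω n := by
  induction n with
  | zero => rfl
  | succ n ih =>
    rw [historyUpTo, ih, processUpTo]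
    simp [streamReader]

lemma history_eq_process : history k s = process k s (streamReader m r) := by
  funext ω n
  simp [history, process, historyUpTo_eq_processUpTo, streamReader]

/-- The values for which the plan after history `h` may lead to the feedback `fb`. -/
def consistentValues (h : List (Feedback m r)) (fb : Feedback m r) : Set ℝ :=
  {v | ∃ f₀, roundFeedback k (s h v) f₀ = fb}

/-- The restriction that the history `h` puts on the value of consumer `i`. -/
def valueRect (h : List (Feedback m r)) (i : ℕ) : Set ℝ :=
  {v | ∀ h' fb, h' ++ [fb] <+: h → h'.length = i → v ∈ consistentValues k s h' fb}

/-- The restriction that the history `h` puts on the screens of business `j` in position `i`. -/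
def screenRect (h : List (Feedback m r)) (j : Fin m) (i : ℕ) : Set (Fin r → Bool) :=
  {z | ∀ h' fb o, h' ++ [fb] <+: h → fb.outcome j = some o → ρ h' j = i → firstFailed z = o}

variable {k s ρ ω}

lemma mem_valueRect_concat {h : List (Feedback m r)} {fb : Feedback m r} {i : ℕ} {v : ℝ} :
    v ∈ valueRect k s (h ++ [fb]) i ↔
      v ∈ valueRect k s h i ∧ (h.length = i → v ∈ consistentValues k s h fb) := by
  simp only [valueRect, mem_ofPred_eq, List.prefix_concat_iff]
  constructor
  · exact fun H => ⟨fun h' fb' hp hl => H h' fb' (Or.inr hp) hl, fun hl => H h fb (Or.inl rfl) hl⟩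
  · rintro ⟨H1, H2⟩ h' fb' (hp | hp) hl
    · obtain ⟨rfl, hfb⟩ := List.append_inj' hp rfl
      simp only [List.cons.injEq, and_true] at hfb
      subst hfb
      exact H2 hl
    · exact H1 h' fb' hp hl

lemma mem_screenRect_concat {h : List (Feedback m r)} {fb : Feedback m r} {j : Fin m} {i : ℕ}
    {z : Fin r → Bool} : z ∈ screenRect ρ (h ++ [fb]) j i ↔
      z ∈ screenRect ρ h j i ∧
        ∀ o, fb.outcome j = some o → ρ h j = i → firstFailed z = o := by
  simp only [screenRect, mem_ofPred_eq, List.prefix_concat_iff]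
  constructor
  · exact fun H => ⟨fun h' fb' o hp ho hl => H h' fb' o (Or.inr hp) ho hl,
      fun o ho hl => H h fb o (Or.inl rfl) ho hl⟩
  · rintro ⟨H1, H2⟩ h' fb' o (hp | hp) ho hl
    · obtain ⟨rfl, hfb⟩ := List.append_inj' hp rfl
      simp only [List.cons.injEq, and_true] at hfb
      subst hfb
      exact H2 o ho hl
    · exact H1 h' fb' o hp ho hl

lemma valueRect_eq_univ {h : List (Feedback m r)} {i : ℕ} (hi : h.length ≤ i) :
    valueRect k s h i = univ := by
  refine eq_univ_of_forall fun v h' fb hp hl => ?_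
  have := hp.length_le
  simp at this
  omega

/-- Every inspection strictly advances the reader, so positions from the current one onwards have
never been read. -/
lemma IsFresh.screenRect_eq_univ (hρ : IsFresh ρ) {h : List (Feedback m r)} {j : Fin m} {i : ℕ}
    (hi : ρ h j ≤ i) : screenRect ρ h j i = univ := by
  induction h using List.reverseRecOn generalizing i with
  | nil => exact eq_univ_of_forall fun z h' fb o hp => by simp at hp
  | append_singleton h fb ih =>
    refine eq_univ_of_forall fun z => mem_screenRect_concat.2 ⟨?_, fun o ho hl => ?_⟩
    · rw [ih ((hρ.mono h fb j).trans hi)]; trivial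
    · have := hρ.lt h fb j (by simp [ho])
      omega

/-- By `roundFeedback_eq_iff` each round imposes a condition on the current value and, separately,
one on the screens read at each inspected business. Hence fixing a finite history is a rectangle in
the coordinates of the stream, and its probability is a product. -/
lemma processUpTo_eq_iff (hs : ∀ h v, ∃ l, s h v = indexPlan l) (h : List (Feedback m r)) :
    processUpTo k s ρ ω h.length = h ↔
      ∀ i, (ω i).1 ∈ valueRect k s h i ∧ ∀ j, (ω i).2 j ∈ screenRect ρ h j i := by
  induction h using List.reverseRecOn with
  | nil =>
    simp [processUpTo, valueRect, screenRect]
  | append_singleton h fb ih =>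
    have h1 : processUpTo k s ρ ω (h ++ [fb]).length = h ++ [fb] ↔
        processUpTo k s ρ ω h.length = h ∧ roundFeedback k (s h (ω h.length).1)
          (fun j => (ω (ρ h j)).2 j) = fb := by
      rw [List.length_append, List.length_singleton, processUpTo_succ]
      constructor
      · intro e
        obtain ⟨e1, e2⟩ := List.append_inj' e rfl
        rw [List.cons.injEq] at e2
        refine ⟨e1, ?_⟩
        have := e2.1
        rwa [process, e1] at this
      · rintro ⟨e1, e2⟩
        rw [process, e1, e2]
    obtain ⟨l, hl⟩ := hs h (ω h.length).1
    rw [h1, ih, hl, roundFeedback_eq_iff, ← hl]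
    simp only [mem_valueRect_concat, mem_screenRect_concat]
    constructor
    · rintro ⟨H1, H2, H3⟩ i
      refine ⟨⟨(H1 i).1, ?_⟩, fun j => ⟨(H1 i).2 j, ?_⟩⟩
      · rintro rfl; exact H2
      · rintro o ho rfl; exact H3 j o ho
    · intro H
      exact ⟨fun i => ⟨(H i).1.1, fun j => ((H i).2 j).1⟩, (H h.length).1.2 rfl,
        fun j o ho => ((H (ρ h j)).2 j).2 o ho rfl⟩

lemma measurableSet_consistentValues (hs : ∀ h v, ∃ l, s h v = indexPlan l)
    (hm : ∀ h p, MeasurableSet {v | s h v = p}) (h : List (Feedback m r)) (fb : Feedback m r) :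
    MeasurableSet (consistentValues k s h fb) := by
  have : consistentValues k s h fb = ⋃ l : List (Fin m),
      {v | s h v = indexPlan l} ∩ {_v | ∃ f₀, roundFeedback k (indexPlan l) f₀ = fb} := by
    ext v
    simp only [consistentValues, mem_ofPred_eq, mem_iUnion, mem_inter_iff]
    constructor
    · rintro ⟨f₀, hf⟩
      obtain ⟨l, hl⟩ := hs h v
      exact ⟨l, hl, f₀, hl ▸ hf⟩
    · rintro ⟨l, hl, f₀, hf⟩
      exact ⟨f₀, hl ▸ hf⟩
  rw [this]
  exact MeasurableSet.iUnion fun l => (hm h _).inter (MeasurableSet.const _)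

lemma measurableSet_valueRect (hs : ∀ h v, ∃ l, s h v = indexPlan l)
    (hm : ∀ h p, MeasurableSet {v | s h v = p}) (h : List (Feedback m r)) (i : ℕ) :
    MeasurableSet (valueRect k s h i) := by
  have : valueRect k s h i = ⋂ h', ⋂ fb, ⋂ (_ : h' ++ [fb] <+: h), ⋂ (_ : h'.length = i),
      consistentValues k s h' fb := by
    ext v
    simp [valueRect]
  rw [this]
  exact MeasurableSet.iInter fun h' => MeasurableSet.iInter fun fb => MeasurableSet.iInter fun _ =>
    MeasurableSet.iInter fun _ => measurableSet_consistentValues hs hm h' fb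

/-- A fresh reader never points beyond the current round, so only finitely many coordinates are
restricted. -/
lemma setOf_processUpTo_eq (hs : ∀ h v, ∃ l, s h v = indexPlan l) (hρ : IsFresh ρ)
    (h : List (Feedback m r)) :
    {ω | processUpTo k s ρ ω h.length = h} = ((Finset.range h.length : Finset ℕ) : Set ℕ).pi
      fun i => valueRect k s h i ×ˢ Set.pi univ fun j => screenRect ρ h j i := by
  ext ω
  rw [mem_ofPred_eq, processUpTo_eq_iff hs]
  simp only [Set.mem_pi, Set.mem_prod, mem_univ, true_implies, Finset.coe_range, mem_Iio]
  refine ⟨fun H i _ => H i, fun H i => ?_⟩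
  by_cases hi : i < h.length
  · exact H i hi
  · refine ⟨by rw [valueRect_eq_univ (not_lt.1 hi)]; trivial, fun j => ?_⟩
    rw [hρ.screenRect_eq_univ ((hρ.le_length h j).trans (not_lt.1 hi))]; trivial

lemma measurableSet_processUpTo (hs : ∀ h v, ∃ l, s h v = indexPlan l)
    (hm : ∀ h p, MeasurableSet {v | s h v = p}) (hρ : IsFresh ρ) (n : ℕ)
    (T : Set (List (Feedback m r))) : MeasurableSet {ω | processUpTo k s ρ ω n ∈ T} := by
  have : {ω | processUpTo k s ρ ω n ∈ T} = ⋃ h ∈ T,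
      {ω | processUpTo k s ρ ω h.length = h} ∩ {_ω | h.length = n} := by
    ext ω
    simp only [mem_ofPred_eq, mem_iUnion, mem_inter_iff, exists_prop]
    constructor
    · intro h
      exact ⟨_, h, by simp, by simp⟩
    · rintro ⟨h, hT, h1, rfl⟩
      rwa [h1]
  rw [this]
  refine MeasurableSet.biUnion (to_countable T) fun h _ => MeasurableSet.inter ?_
    (MeasurableSet.const _)
  rw [setOf_processUpTo_eq hs hρ]
  exact MeasurableSet.pi (Finset.countable_toSet _) fun i _ =>
    (measurableSet_valueRect hs hm h i).prod
      (MeasurableSet.pi countable_univ fun j _ => MeasurableSet.of_discrete)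

lemma measurable_process (hs : ∀ h v, ∃ l, s h v = indexPlan l)
    (hm : ∀ h p, MeasurableSet {v | s h v = p}) (hρ : IsFresh ρ) :
    Measurable (process k s ρ) := by
  refine measurable_pi_lambda _ fun n => fun S _ => ?_
  have : (fun ω => process k s ρ ω n) ⁻¹' S =
      {ω | processUpTo k s ρ ω (n + 1) ∈ {h | ∃ h' fb, h = h' ++ [fb] ∧ fb ∈ S}} := by
    ext ω
    simp only [mem_preimage, mem_ofPred_eq, processUpTo_succ]
    constructor
    · exact fun h => ⟨_, _, rfl, h⟩
    · rintro ⟨h', fb, e, hfb⟩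
      have := (List.append_inj' e rfl).2
      rw [List.cons.injEq] at this
      rwa [this.1]
  rw [this]
  exact measurableSet_processUpTo hs hm hρ _ _

end Histories

/-! ### The law of a history and its independence of the reader -/

namespace ScreenMarket

variable {m r : ℕ} (E : ScreenMarket m r)

/-- The probability that the inspection of business `j` has outcome `o`. -/
noncomputable def outcomeProb (j : Fin m) (x : Fin r → unitInterval) (o : WithTop (Fin r)) : ℝ≥0∞ :=
  E.screenLaw j x {z | firstFailed z = o}

/-- The factor of the likelihood of a public history that depends on the values. -/
noncomputable def valueFactor (k : ℕ) (s : Strategy m r) (h : List (Feedback m r)) : ℝ≥0∞ :=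
  ∏ i ∈ Finset.range h.length, E.valueLaw (valueRect k s h i)

/-- Each inspection constrains a position that was free before, hence contributes exactly one
outcome probability. The range `N` is left free so that the induction on the history can keep it
fixed. -/
lemma prod_screenLaw_screenRect {ρ : Reader m r} (hρ : IsFresh ρ) (x : Profile m r) (j : Fin m)
    (h : List (Feedback m r)) {N : ℕ} (hN : h.length ≤ N) :
    ∏ i ∈ Finset.range N, E.screenLaw j (x j) (screenRect ρ h j i)
      = ((outs j h).map (E.outcomeProb j (x j))).prod := by
  induction h using List.reverseRecOn with
  | nil =>
    have : ∀ i, screenRect ρ [] j i = univ :=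
      fun i => eq_univ_of_forall fun z h' fb o hp => by simp at hp
    simp [this, outs]
  | append_singleton h fb ih =>
    rw [List.length_append, List.length_singleton] at hN
    specialize ih (by omega)
    rcases ho : fb.outcome j with _ | o
    · rw [outs_concat_none ho, ← ih]
      refine Finset.prod_congr rfl fun i _ => ?_
      congr 1
      ext z
      simp [mem_screenRect_concat, ho]
    · have hmem : ρ h j ∈ Finset.range N := by
        have := hρ.le_length h j
        simp; omega
      rw [outs_concat_some ho, List.map_append, List.prod_append, ← ih,
        ← Finset.mul_prod_erase _ _ hmem, ← Finset.mul_prod_erase _ _ hmem,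
        hρ.screenRect_eq_univ (le_refl (ρ h j)), measure_univ, one_mul, mul_comm]
      congr 1
      · refine Finset.prod_congr rfl fun i hi => ?_
        congr 1
        ext z
        have := Finset.ne_of_mem_erase hi
        simp [mem_screenRect_concat, this.symm]
      · rw [List.map_singleton, List.prod_singleton, outcomeProb]
        congr 1
        ext z
        rw [mem_screenRect_concat, hρ.screenRect_eq_univ (le_refl (ρ h j))]
        simp [ho, eq_comm]

instance (x : Profile m r) : IsProbabilityMeasure (E.streamLaw x) := by
  unfold streamLaw; infer_instance

variable {E}

/-- The right-hand side does not mention `ρ`. This is both the likelihood formula and the reason why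
the stack model has the law of the original one. -/
lemma streamLaw_processUpTo_eq {k : ℕ} {s : Strategy m r} {ρ : Reader m r}
    (hs : ∀ h v, ∃ l, s h v = indexPlan l) (hm : ∀ h p, MeasurableSet {v | s h v = p})
    (hρ : IsFresh ρ) (x : Profile m r) (h : List (Feedback m r)) :
    E.streamLaw x {ω | processUpTo k s ρ ω h.length = h} =
      E.valueFactor k s h * ∏ j, ((outs j h).map (E.outcomeProb j (x j))).prod := by
  rw [setOf_processUpTo_eq hs hρ, streamLaw, Measure.infinitePi_pi _ fun i _ =>
    (measurableSet_valueRect hs hm h i).prod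
      (MeasurableSet.pi countable_univ fun j _ => MeasurableSet.of_discrete)]
  simp only [consumerLaw, Measure.prod_prod, Measure.pi_pi]
  rw [Finset.prod_mul_distrib, Finset.prod_comm]
  simp only [E.prod_screenLaw_screenRect hρ x _ h le_rfl]
  rfl

lemma likelihood_eq {k : ℕ} {s : Strategy m r}
    (hs : ∀ h v, ∃ l, s h v = indexPlan l) (hm : ∀ h p, MeasurableSet {v | s h v = p})
    (x : Profile m r) (h : List (Feedback m r)) :
    E.likelihood k s h x =
      E.valueFactor k s h * ∏ j, ((outs j h).map (E.outcomeProb j (x j))).prod := by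
  rw [← streamLaw_processUpTo_eq hs hm (isFresh_streamReader m r) x h, likelihood]
  simp only [historyUpTo_eq_processUpTo]

lemma streamLaw_processUpTo_mem_congr {k : ℕ} {s : Strategy m r} {ρ ρ' : Reader m r}
    (hs : ∀ h v, ∃ l, s h v = indexPlan l) (hm : ∀ h p, MeasurableSet {v | s h v = p})
    (hρ : IsFresh ρ) (hρ' : IsFresh ρ') (x : Profile m r) (n : ℕ)
    (T : Set (List (Feedback m r))) :
    E.streamLaw x {ω | processUpTo k s ρ ω n ∈ T} =
      E.streamLaw x {ω | processUpTo k s ρ' ω n ∈ T} := by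
  let _ : MeasurableSpace (List (Feedback m r)) := ⊤
  have hmeas : ∀ {ρ : Reader m r}, IsFresh ρ → Measurable fun ω => processUpTo k s ρ ω n :=
    fun h S _ => measurableSet_processUpTo hs hm h n S
  have key : (E.streamLaw x).map (fun ω => processUpTo k s ρ ω n) =
      (E.streamLaw x).map (fun ω => processUpTo k s ρ' ω n) := by
    refine Measure.ext_of_singleton fun h => ?_
    rw [Measure.map_apply (hmeas hρ) trivial, Measure.map_apply (hmeas hρ') trivial]
    by_cases hn : h.length = n
    · subst hn
      exact (streamLaw_processUpTo_eq hs hm hρ x h).trans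
        (streamLaw_processUpTo_eq hs hm hρ' x h).symm
    · have : ∀ ρ : Reader m r, (fun ω => processUpTo k s ρ ω n) ⁻¹' {h} = ∅ := by
        intro ρ
        refine eq_empty_of_forall_notMem fun ω hω => hn ?_
        rw [mem_preimage, mem_singleton_iff] at hω
        rw [← hω, length_processUpTo]
      rw [this, this]
  have := congrArg (fun μ => μ T) key
  simp only [Measure.map_apply (hmeas hρ) trivial, Measure.map_apply (hmeas hρ') trivial] at this
  exact this

/-- A finite measure on sequences is determined by its finite-dimensional marginals, and an event
about finitely many rounds is an event about a long enough prefix. -/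
lemma map_process_congr {k : ℕ} {s : Strategy m r} {ρ ρ' : Reader m r}
    (hs : ∀ h v, ∃ l, s h v = indexPlan l) (hm : ∀ h p, MeasurableSet {v | s h v = p})
    (hρ : IsFresh ρ) (hρ' : IsFresh ρ') (x : Profile m r) :
    (E.streamLaw x).map (process k s ρ) = (E.streamLaw x).map (process k s ρ') := by
  have h1 := measurable_process (k := k) hs hm hρ
  have h2 := measurable_process (k := k) hs hm hρ'
  have : IsProbabilityMeasure ((E.streamLaw x).map (process k s ρ')) :=
    Measure.isProbabilityMeasure_map h2.aemeasurable
  have hI : ∀ I : Finset ℕ, IsFiniteMeasure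
      (((E.streamLaw x).map (process k s ρ')).map I.restrict) := fun I => by infer_instance
  refine IsProjectiveLimit.unique
    (P := fun I => ((E.streamLaw x).map (process k s ρ')).map I.restrict) (fun I => ?_) fun I => rfl
  refine Measure.ext fun S hS => ?_
  have hr : Measurable (I.restrict (π := fun _ : ℕ => Feedback m r)) := Finset.measurable_restrict I
  rw [Measure.map_apply hr hS, Measure.map_apply hr hS, Measure.map_apply h1 (hr hS),
    Measure.map_apply h2 (hr hS)]
  obtain ⟨n, hn⟩ := I.exists_nat_subset_range
  have key : ∀ ρ : Reader m r, process k s ρ ⁻¹' (I.restrict ⁻¹' S) =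
      {ω | processUpTo k s ρ ω n ∈
        {h | ∃ H : ℕ → Feedback m r, historyPrefix H n = h ∧ I.restrict H ∈ S}} := by
    intro ρ
    ext ω
    simp only [mem_preimage, mem_ofPred_eq]
    constructor
    · exact fun h => ⟨_, historyPrefix_process k s ρ ω n, h⟩
    · rintro ⟨H, hH, hS⟩
      rw [← historyPrefix_process] at hH
      have : I.restrict (process k s ρ ω) = I.restrict H := by
        funext i
        have hi := Finset.mem_range.1 (hn i.2)
        have := List.map_inj_left.1 hH i.1 (List.mem_range.2 hi)
        exact this.symm
      rwa [this]
  rw [key, key]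
  exact streamLaw_processUpTo_mem_congr hs hm hρ hρ' x n _

end ScreenMarket
/-! ### Normalized densities -/

/-- The probability measure with density proportional to `f` with respect to `μ`. -/
noncomputable def tilt {α : Type*} [MeasurableSpace α] (μ : Measure α) (f : α → ℝ≥0∞) : Measure α :=
  (∫⁻ x, f x ∂μ)⁻¹ • μ.withDensity f

section Tilt

variable {α : Type*} [MeasurableSpace α] {μ : Measure α} {f : α → ℝ≥0∞}

lemma tilt_apply {s : Set α} (hs : MeasurableSet s) :
    tilt μ f s = (∫⁻ x, f x ∂μ)⁻¹ * ∫⁻ x in s, f x ∂μ := by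
  rw [tilt, Measure.smul_apply, withDensity_apply _ hs, smul_eq_mul]

lemma isProbabilityMeasure_tilt (h0 : ∫⁻ x, f x ∂μ ≠ 0) (h1 : ∫⁻ x, f x ∂μ ≠ ∞) :
    IsProbabilityMeasure (tilt μ f) :=
  ⟨by rw [tilt_apply MeasurableSet.univ, Measure.restrict_univ, ENNReal.inv_mul_cancel h0 h1]⟩

lemma tilt_const_mul {c : ℝ≥0∞} (hc : c ≠ 0) (hc' : c ≠ ∞) (hf : Measurable f) :
    tilt μ (fun x => c * f x) = tilt μ f := by
  have h1 : (fun x => c * f x) = c • f := rfl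
  rw [tilt, lintegral_const_mul c hf, h1, withDensity_smul c hf, smul_smul, tilt,
    ENNReal.mul_inv (Or.inl hc) (Or.inl hc'), mul_comm c⁻¹, mul_assoc,
    ENNReal.inv_mul_cancel hc hc', mul_one]

lemma lintegral_pi_prod {ι : Type*} [Fintype ι] {β : ι → Type*} [∀ i, MeasurableSpace (β i)]
    (μ : ∀ i, Measure (β i)) [∀ i, IsProbabilityMeasure (μ i)] {f : ∀ i, β i → ℝ≥0∞}
    (hf : ∀ i, Measurable (f i)) :
    ∫⁻ x, ∏ i, f i (x i) ∂Measure.pi μ = ∏ i, ∫⁻ y, f i y ∂μ i := by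
  rw [lintegral_prod_eq_prod_lintegral_of_indepFun (μ := Measure.pi μ) Finset.univ
    (fun i x => f i (x i)) (iIndepFun_pi fun i => (hf i).aemeasurable)
    fun i => (hf i).comp (measurable_pi_apply i)]
  exact Finset.prod_congr rfl fun i _ => (measurePreserving_eval μ i).lintegral_comp (hf i)

/-- Bayes' rule preserves independence when the likelihood factorizes along the same coordinates as
the prior. It is applied twice, over businesses and over screens. -/
lemma tilt_pi {ι : Type*} [Fintype ι] {β : ι → Type*} [∀ i, MeasurableSpace (β i)]
    (μ : ∀ i, Measure (β i)) [∀ i, IsProbabilityMeasure (μ i)] {f : ∀ i, β i → ℝ≥0∞}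
    (hf : ∀ i, Measurable (f i)) (h0 : ∀ i, ∫⁻ y, f i y ∂μ i ≠ 0)
    (h1 : ∀ i, ∫⁻ y, f i y ∂μ i ≠ ∞) :
    tilt (Measure.pi μ) (fun x => ∏ i, f i (x i)) = Measure.pi fun i => tilt (μ i) (f i) := by
  have : ∀ i, IsProbabilityMeasure (tilt (μ i) (f i)) :=
    fun i => isProbabilityMeasure_tilt (h0 i) (h1 i)
  symm
  refine Measure.pi_eq fun s hs => ?_
  have hind : ∀ x : ∀ i, β i, (Set.pi univ s).indicator (fun x => ∏ i, f i (x i)) x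
      = ∏ i, (s i).indicator (f i) (x i) := by
    classical
    intro x
    by_cases hx : x ∈ Set.pi univ s
    · rw [indicator_of_mem hx]
      exact Finset.prod_congr rfl fun i _ => by rw [indicator_of_mem (hx i (mem_univ i))]
    · rw [indicator_of_notMem hx]
      simp only [Set.mem_pi, mem_univ, true_implies, not_forall] at hx
      obtain ⟨i, hi⟩ := hx
      exact (Finset.prod_eq_zero (Finset.mem_univ i) (indicator_of_notMem hi _)).symm
  rw [tilt_apply (MeasurableSet.univ_pi hs), lintegral_pi_prod μ hf,
    ← lintegral_indicator (MeasurableSet.univ_pi hs)]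
  simp_rw [hind]
  rw [lintegral_pi_prod μ fun i => (hf i).indicator (hs i)]
  simp_rw [tilt_apply (hs _), lintegral_indicator (hs _)]
  rw [Finset.prod_mul_distrib]
  congr 1
  refine ENNReal.prod_inv_distrib ?_
  intro i _ j _ _
  exact Or.inl (h0 i)

end Tilt

/-! ### The likelihood of outcomes -/

/-- The factor of the probability of the outcome `o` that is due to screen `l` with parameter
`t`. -/
noncomputable def screenFactor {r : ℕ} (l : Fin r) (o : WithTop (Fin r)) (t : ℝ) : ℝ :=
  open Classical in
  if (l : WithTop (Fin r)) < o then t else if o = l then 1 - t else 1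

lemma screenFactor_nonneg {r : ℕ} (l : Fin r) (o : WithTop (Fin r)) (t : unitInterval) :
    0 ≤ screenFactor l o t := by
  unfold screenFactor
  split_ifs
  · exact t.2.1
  · linarith [t.2.2]
  · exact zero_le_one

lemma screenFactor_le_one {r : ℕ} (l : Fin r) (o : WithTop (Fin r)) (t : unitInterval) :
    screenFactor l o t ≤ 1 := by
  unfold screenFactor
  split_ifs
  · exact t.2.2
  · linarith [t.2.1]
  · exact le_rfl

/-- The likelihood of the parameter `t` of screen `l` after the outcomes `os`, as a real number. -/
noncomputable def screenLikelihood {r : ℕ} (l : Fin r) (os : List (WithTop (Fin r)))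
    (t : unitInterval) : ℝ :=
  (os.map fun o => screenFactor l o t).prod

/-- The likelihood of the parameter `t` of screen `l` after the outcomes `os`. -/
noncomputable def screenWeight {r : ℕ} (l : Fin r) (os : List (WithTop (Fin r)))
    (t : unitInterval) : ℝ≥0∞ :=
  ENNReal.ofReal (screenLikelihood l os t)

section ScreenWeight

variable {r : ℕ} (l : Fin r) (os : List (WithTop (Fin r)))

lemma screenLikelihood_append (os' : List (WithTop (Fin r))) (t : unitInterval) :
    screenLikelihood l (os ++ os') t = screenLikelihood l os t * screenLikelihood l os' t := by
  simp [screenLikelihood]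

lemma screenLikelihood_nonneg (t : unitInterval) : 0 ≤ screenLikelihood l os t :=
  List.prod_nonneg fun a ha => by
    obtain ⟨o, -, rfl⟩ := List.mem_map.1 ha
    exact screenFactor_nonneg l o t

lemma screenLikelihood_le_one (t : unitInterval) : screenLikelihood l os t ≤ 1 := by
  induction os with
  | nil => simp [screenLikelihood]
  | cons o os ih =>
    simp only [screenLikelihood, List.map_cons, List.prod_cons]
    exact mul_le_one₀ (screenFactor_le_one l o t) (screenLikelihood_nonneg l os t) ih

lemma continuous_screenWeight : Continuous (screenWeight l os) := by
  refine ENNReal.continuous_ofReal.comp ?_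
  unfold screenLikelihood
  induction os with
  | nil => simpa using continuous_const
  | cons o os ih =>
    simp only [List.map_cons, List.prod_cons]
    refine Continuous.mul ?_ ih
    unfold screenFactor
    split_ifs <;> fun_prop

lemma screenWeight_le_one (t : unitInterval) : screenWeight l os t ≤ 1 :=
  ENNReal.ofReal_le_one.2 (screenLikelihood_le_one l os t)

lemma screenWeight_append (os' : List (WithTop (Fin r))) (t : unitInterval) :
    screenWeight l (os ++ os') t = screenWeight l os t * screenWeight l os' t := by
  rw [screenWeight, screenLikelihood_append, ENNReal.ofReal_mul (screenLikelihood_nonneg l os t)]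
  rfl

lemma screenWeight_cons (o : WithTop (Fin r)) (t : unitInterval) :
    screenWeight l (o :: os) t = ENNReal.ofReal (screenFactor l o t) * screenWeight l os t := by
  rw [← List.singleton_append, screenWeight_append]
  simp [screenWeight, screenLikelihood]

end ScreenWeight

lemma fitProb_succ {r : ℕ} (l : Fin r) (x : Fin r → unitInterval) :
    fitProb (l + 1) x = fitProb l x * x l := by
  have : Finset.univ.filter (fun i : Fin r => (i : ℕ) < l + 1)
      = insert l (Finset.univ.filter (fun i : Fin r => (i : ℕ) < l)) := by
    ext i
    simp [Fin.ext_iff]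
    omega
  rw [fitProb, this, Finset.prod_insert (by simp), mul_comm, fitProb]

namespace ScreenMarket

variable {m r : ℕ} (E : ScreenMarket m r)

lemma screenLaw_fitOf (j : Fin m) (x : Fin r → unitInterval) {k : ℕ} (hk : k ≤ r) :
    E.screenLaw j x {f | fitOf k f = true} = ENNReal.ofReal (fitProb k x) := by
  rcases k with _ | k
  · have : {f : Fin r → Bool | fitOf 0 f = true} = univ :=
      eq_univ_of_forall fun f => fitOf_iff.2 fun l hl => absurd hl (by omega)
    rw [this, measure_univ]
    simp [fitProb]
  · have h1 := E.screenLaw_pass j x ⟨k, hk⟩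
    have h2 : {f : Fin r → Bool | ∀ i ≤ (⟨k, hk⟩ : Fin r), f i = true}
        = {f | fitOf (k + 1) f = true} := by
      ext f
      simp only [mem_ofPred_eq, fitOf_iff, Fin.le_def, Nat.lt_succ_iff]
    have h3 : Finset.Iic (⟨k, hk⟩ : Fin r) = Finset.univ.filter fun i : Fin r => (i : ℕ) < k + 1 := by
      ext i
      simp [Fin.le_def]
    rw [← h2, h1, h3, fitProb]

/-- By the chain rule, failing first at `l` means passing all earlier screens and then failing `l`.
Later screens are not observed and contribute `1`, so arbitrary correlation among them is harmless.
-/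
lemma outcomeProb_eq (j : Fin m) (x : Fin r → unitInterval) (o : WithTop (Fin r)) :
    E.outcomeProb j x o = ∏ l, ENNReal.ofReal (screenFactor l o (x l)) := by
  classical
  rw [← ENNReal.ofReal_prod_of_nonneg fun l _ => screenFactor_nonneg l o (x l), outcomeProb]
  induction o using WithTop.recTopCoe with
  | top =>
    simp only [firstFailed_eq_top, E.screenLaw_fitOf j x le_rfl]
    simp [screenFactor, fitProb_eq_prod]
  | coe l =>
    have h1 : {z : Fin r → Bool | firstFailed z = l}
        = {z | fitOf l z = true} \ {z | fitOf (l + 1) z = true} := by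
      ext z
      rw [Set.mem_sdiff, mem_ofPred_eq, mem_ofPred_eq, mem_ofPred_eq, ← le_firstFailed,
        ← lt_firstFailed, not_lt]
      exact ⟨fun h => ⟨h.ge, h.le⟩, fun h => le_antisymm h.2 h.1⟩
    have h2 : {z : Fin r → Bool | fitOf (l + 1) z = true} ⊆ {z | fitOf l z = true} := by
      intro z hz
      exact fitOf_iff.2 fun i hi => fitOf_iff.1 hz i (by omega)
    rw [h1, measure_sdiff h2 MeasurableSet.of_discrete.nullMeasurableSet (measure_ne_top _ _),
      E.screenLaw_fitOf j x l.2.le, E.screenLaw_fitOf j x l.2,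
      ← ENNReal.ofReal_sub _ (fitProb_nonneg _ _), fitProb_succ, fitProb_eq_prod]
    congr 1
    have h3 : ∀ i : Fin r, screenFactor i (l : WithTop (Fin r)) (x i : ℝ)
        = (if (i : ℕ) < l then (x i : ℝ) else 1) * if i = l then 1 - (x l : ℝ) else 1 := by
      intro i
      simp only [screenFactor, WithTop.coe_lt_coe, WithTop.coe_inj, Fin.lt_def]
      rcases lt_trichotomy (i : ℕ) l with h | h | h
      · simp [h, Fin.ext_iff, h.ne]
      · obtain rfl := Fin.ext h
        simp
      · have h' : l ≠ i := fun e => h.ne (by rw [e])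
        simp [h.not_gt, h', h'.symm]
    simp only [h3, Finset.prod_mul_distrib, Finset.prod_ite_eq', Finset.mem_univ, if_true]
    ring

lemma prod_outcomeProb (j : Fin m) (x : Fin r → unitInterval) (os : List (WithTop (Fin r))) :
    (os.map (E.outcomeProb j x)).prod = ∏ l, screenWeight l os (x l) := by
  induction os with
  | nil => simp [screenWeight, screenLikelihood]
  | cons o os ih =>
    rw [List.map_cons, List.prod_cons, ih, outcomeProb_eq, ← Finset.prod_mul_distrib]
    simp only [screenWeight_cons]

/-- The outcomes `os` of the inspections of business `j` are possible under the true parameters. -/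
def Possible (j : Fin m) (os : List (WithTop (Fin r))) : Prop :=
  ∀ l, screenWeight l os (E.param j l) ≠ 0

/-- Posterior of the parameter of screen `l` of business `j` after the outcomes `os`. -/
noncomputable def screenPosterior (j : Fin m) (os : List (WithTop (Fin r))) (l : Fin r) :
    Measure unitInterval :=
  tilt (E.prior j l) (screenWeight l os)

/-- Posterior of the screen parameters of business `j` after the outcomes `os`. -/
noncomputable def businessPosterior (j : Fin m) (os : List (WithTop (Fin r))) :
    Measure (Fin r → unitInterval) :=
  Measure.pi (E.screenPosterior j os)

variable {E}

lemma lintegral_screenWeight_ne_top (j : Fin m) (os : List (WithTop (Fin r))) (l : Fin r) :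
    ∫⁻ t, screenWeight l os t ∂E.prior j l ≠ ∞ := by
  refine ne_top_of_le_ne_top ENNReal.one_ne_top ?_
  calc ∫⁻ t, screenWeight l os t ∂E.prior j l ≤ ∫⁻ _, 1 ∂E.prior j l :=
        lintegral_mono fun t => screenWeight_le_one l os t
    _ = 1 := by simp

/-- The likelihood is continuous and nonzero at the true parameter, hence nonzero on a
neighbourhood, which the prior charges. -/
lemma Possible.lintegral_ne_zero {j : Fin m} {os : List (WithTop (Fin r))} (h : E.Possible j os)
    (l : Fin r) : ∫⁻ t, screenWeight l os t ∂E.prior j l ≠ 0 := by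
  rw [Ne, lintegral_eq_zero_iff (continuous_screenWeight l os).measurable]
  intro h0
  have hopen : IsOpen {t | screenWeight l os t ≠ 0} :=
    isOpen_ne.preimage (continuous_screenWeight l os)
  have := (Measure.mem_support_iff_forall _).1 (E.param_mem_support j l) _ (hopen.mem_nhds (h l))
  exact this.ne' h0

lemma Possible.isProbabilityMeasure_screenPosterior {j : Fin m} {os : List (WithTop (Fin r))}
    (h : E.Possible j os) (l : Fin r) : IsProbabilityMeasure (E.screenPosterior j os l) :=
  isProbabilityMeasure_tilt (h.lintegral_ne_zero l) (lintegral_screenWeight_ne_top j os l)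

lemma Possible.isProbabilityMeasure_businessPosterior {j : Fin m} {os : List (WithTop (Fin r))}
    (h : E.Possible j os) : IsProbabilityMeasure (E.businessPosterior j os) := by
  have := h.isProbabilityMeasure_screenPosterior
  unfold businessPosterior
  infer_instance

lemma likelihood_eq_prod {k : ℕ} {s : Strategy m r}
    (hs : ∀ h v, ∃ l, s h v = indexPlan l) (hm : ∀ h p, MeasurableSet {v | s h v = p})
    (h : List (Feedback m r)) (x : Profile m r) :
    E.likelihood k s h x =
      E.valueFactor k s h * ∏ j, ∏ l, screenWeight l (outs j h) (x j l) := by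
  rw [likelihood_eq hs hm]
  simp only [prod_outcomeProb]

lemma possible_of_likelihood_ne_zero {k : ℕ} {s : Strategy m r}
    (hs : ∀ h v, ∃ l, s h v = indexPlan l) (hm : ∀ h p, MeasurableSet {v | s h v = p})
    {h : List (Feedback m r)} (h0 : E.likelihood k s h E.param ≠ 0) (j : Fin m) :
    E.Possible j (outs j h) := by
  rw [likelihood_eq_prod hs hm, mul_ne_zero_iff] at h0
  intro l
  have h1 := Finset.prod_ne_zero_iff.1 h0.2 j (Finset.mem_univ j)
  exact Finset.prod_ne_zero_iff.1 h1 l (Finset.mem_univ l)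

/-- After a possible history, the posterior is a product over businesses and screens. -/
theorem posterior_eq {k : ℕ} {s : Strategy m r}
    (hs : ∀ h v, ∃ l, s h v = indexPlan l) (hm : ∀ h p, MeasurableSet {v | s h v = p})
    {h : List (Feedback m r)} (h0 : E.likelihood k s h E.param ≠ 0) :
    E.posterior k s h = Measure.pi fun j => E.businessPosterior j (outs j h) := by
  have hp := possible_of_likelihood_ne_zero hs hm h0
  have hm1 : ∀ l os, Measurable (screenWeight (r := r) l os) :=
    fun l os => (continuous_screenWeight l os).measurable
  have hm2 : ∀ j : Fin m, Measurable fun y : Fin r → unitInterval =>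
      ∏ l, screenWeight l (outs j h) (y l) :=
    fun j => Finset.measurable_prod _ fun l _ => (hm1 l _).comp (measurable_pi_apply l)
  have hv0 : E.valueFactor k s h ≠ 0 := by
    rw [likelihood_eq_prod hs hm, mul_ne_zero_iff] at h0
    exact h0.1
  have hvt : E.valueFactor k s h ≠ ∞ := ENNReal.prod_ne_top fun i _ => measure_ne_top _ _
  have h1 : E.posterior k s h = tilt E.jointPrior (E.likelihood k s h) := rfl
  have h2 : E.likelihood k s h = fun x =>
      E.valueFactor k s h * ∏ j, (fun y : Fin r → unitInterval =>
        ∏ l, screenWeight l (outs j h) (y l)) (x j) := funext (likelihood_eq_prod hs hm h)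
  have h3 : ∀ j, ∫⁻ y : Fin r → unitInterval, ∏ l, screenWeight l (outs j h) (y l)
      ∂Measure.pi (E.prior j) = ∏ l, ∫⁻ t, screenWeight l (outs j h) t ∂E.prior j l :=
    fun j => lintegral_pi_prod _ fun l => hm1 l _
  have h4 : Measurable fun x : Profile m r =>
      ∏ j, (fun y : Fin r → unitInterval => ∏ l, screenWeight l (outs j h) (y l)) (x j) :=
    Finset.measurable_prod _ fun j _ => (hm2 j).comp (measurable_pi_apply j)
  -- The value factor does not depend on the parameters and cancels in the normalization; what
  -- remains is a product density against a product prior.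
  rw [h1, h2, tilt_const_mul hv0 hvt h4, jointPrior,
    tilt_pi (fun j => Measure.pi (E.prior j)) hm2]
  · congr 1
    funext j
    exact tilt_pi (E.prior j) (fun l => hm1 l _) (fun l => (hp j).lintegral_ne_zero l)
      fun l => lintegral_screenWeight_ne_top j _ l
  · intro j
    rw [h3]
    exact Finset.prod_ne_zero_iff.2 fun l _ => (hp j).lintegral_ne_zero l
  · intro j
    rw [h3]
    exact ENNReal.prod_ne_top fun l _ => lintegral_screenWeight_ne_top j _ l

lemma map_posterior {k : ℕ} {s : Strategy m r}
    (hs : ∀ h v, ∃ l, s h v = indexPlan l) (hm : ∀ h p, MeasurableSet {v | s h v = p})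
    {h : List (Feedback m r)} (h0 : E.likelihood k s h E.param ≠ 0) (j : Fin m) :
    (E.posterior k s h).map (fun x => x j) = E.businessPosterior j (outs j h) := by
  have := fun j => (possible_of_likelihood_ne_zero hs hm h0 j).isProbabilityMeasure_businessPosterior
  rw [posterior_eq hs hm h0]
  exact (measurePreserving_eval _ j).map_eq

/-! ### Posterior means and search indices -/

variable (E)

/-- Posterior mean of the parameter of screen `l` of business `j` after the outcomes `os`. -/
noncomputable def screenMean (j : Fin m) (os : List (WithTop (Fin r))) (l : Fin r) : ℝ :=
  ∫ t, (t : ℝ) ∂E.screenPosterior j os l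

/-- The search index of business `j` after the outcomes `os`. -/
noncomputable def outcomeIndex (k : ℕ) (j : Fin m) (os : List (WithTop (Fin r))) (v : ℝ) : ℝ :=
  searchIndex E.cost v (E.price j) (∏ l : Fin r, if (l : ℕ) < k then E.screenMean j os l else 1)
    (∏ l : Fin r, if k ≤ (l : ℕ) then E.screenMean j os l else 1)

variable {E}

lemma measurable_fitProb (k : ℕ) : Measurable (fitProb (r := r) k) :=
  Finset.measurable_prod _ fun l _ => measurable_subtype_coe.comp (measurable_pi_apply l)

lemma measurable_quality (k : ℕ) : Measurable (quality (r := r) k) :=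
  Finset.measurable_prod _ fun l _ => measurable_subtype_coe.comp (measurable_pi_apply l)

lemma Possible.integral_prod {j : Fin m} {os : List (WithTop (Fin r))} (h : E.Possible j os)
    (p : Fin r → Prop) [DecidablePred p] :
    ∫ y, (∏ l : Fin r, if p l then (y l : ℝ) else 1) ∂E.businessPosterior j os
      = ∏ l : Fin r, if p l then E.screenMean j os l else 1 := by
  have := h.isProbabilityMeasure_screenPosterior
  rw [businessPosterior, integral_fintype_prod_eq_prod
    (f := fun l (t : unitInterval) => if p l then (t : ℝ) else 1)]
  refine Finset.prod_congr rfl fun l _ => ?_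
  split_ifs with hl
  · rfl
  · simp

/-- Posterior independence over screens turns means of products into products of means. The index
thus depends on the history only through the outcomes of `j`, which is what makes the two markets
comparable. -/
lemma searchIndex_mean {k : ℕ} {s : Strategy m r}
    (hs : ∀ h v, ∃ l, s h v = indexPlan l) (hm : ∀ h p, MeasurableSet {v | s h v = p})
    {h : List (Feedback m r)} (h0 : E.likelihood k s h E.param ≠ 0) (j : Fin m) (v : ℝ) :
    searchIndex E.cost v (E.price j) (E.meanFit k s h j) (E.meanQuality k s h j) =
      E.outcomeIndex k j (outs j h) v := by
  have hp := possible_of_likelihood_ne_zero hs hm h0 j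
  have hmap := map_posterior hs hm h0 j
  have h1 : E.meanFit k s h j = ∏ l : Fin r, if (l : ℕ) < k then
      E.screenMean j (outs j h) l else 1 := by
    rw [← hp.integral_prod, ← hmap, integral_map (measurable_pi_apply j).aemeasurable
      (by simpa only [← fitProb_eq_prod] using (measurable_fitProb k).aestronglyMeasurable)]
    simp only [← fitProb_eq_prod]
    rfl
  have h2 : E.meanQuality k s h j = ∏ l : Fin r, if k ≤ (l : ℕ) then
      E.screenMean j (outs j h) l else 1 := by
    rw [← hp.integral_prod, ← hmap, integral_map (measurable_pi_apply j).aemeasurable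
      (by simpa only [← quality_eq_prod] using (measurable_quality k).aestronglyMeasurable)]
    simp only [← quality_eq_prod]
    rfl
  rw [h1, h2, outcomeIndex]

/-- The posterior density is nonzero near the true parameter, so neighbourhoods charged by the prior
remain charged. -/
lemma Possible.param_mem_support {j : Fin m} {os : List (WithTop (Fin r))} (h : E.Possible j os)
    (l : Fin r) : E.param j l ∈ (E.screenPosterior j os l).support := by
  rw [Measure.mem_support_iff_forall]
  intro U hU
  obtain ⟨V, hVU, hV, hmem⟩ := mem_nhds_iff.1 hU
  have hopen : IsOpen {t | screenWeight l os t ≠ 0} :=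
    isOpen_ne.preimage (continuous_screenWeight l os)
  have hpos := (Measure.mem_support_iff_forall _).1 (E.param_mem_support j l) _
    ((hV.inter hopen).mem_nhds ⟨hmem, h l⟩)
  refine lt_of_lt_of_le (pos_iff_ne_zero.2 ?_) (measure_mono hVU)
  rw [screenPosterior, tilt_apply hV.measurableSet]
  refine mul_ne_zero (ENNReal.inv_ne_zero.2 (lintegral_screenWeight_ne_top j os l)) fun h0 => ?_
  rw [setLIntegral_eq_zero_iff hV.measurableSet (continuous_screenWeight l os).measurable] at h0
  refine hpos.ne' (measure_mono_null ?_ h0)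
  rintro t ⟨ht, ht'⟩ hh
  exact ht' (hh ht)

lemma Possible.screenMean_mem {j : Fin m} {os : List (WithTop (Fin r))} (h : E.Possible j os)
    (l : Fin r) : 0 < E.screenMean j os l ∧ E.screenMean j os l ≤ 1 := by
  have := h.isProbabilityMeasure_screenPosterior l
  have hint : Integrable (fun t : unitInterval => (t : ℝ)) (E.screenPosterior j os l) :=
    Integrable.of_bound (C := 1) measurable_subtype_coe.aestronglyMeasurable
      (Eventually.of_forall fun t => by rw [Real.norm_of_nonneg t.2.1]; exact t.2.2)
  constructor
  · rw [screenMean, integral_pos_iff_support_of_nonneg (fun t => t.2.1) hint]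
    refine (Measure.mem_support_iff_forall _).1 (h.param_mem_support l) _ ?_
    have : IsOpen {t : unitInterval | (t : ℝ) ≠ 0} := isOpen_ne.preimage continuous_subtype_val
    exact this.mem_nhds (E.param_pos j l).ne'
  · calc E.screenMean j os l ≤ ∫ _, 1 ∂E.screenPosterior j os l :=
          integral_mono hint (integrable_const 1) fun t => t.2.2
      _ = 1 := by simp

/-- A business worth inspecting stays worth inspecting when inspections reveal more screens. -/
lemma Possible.outcomeIndex_pos {j : Fin m} {os : List (WithTop (Fin r))} (h : E.Possible j os)
    {k k' : ℕ} (hk : k ≤ k') {v : ℝ} (hv : 0 < E.outcomeIndex k j os v) :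
    0 < E.outcomeIndex k' j os v := by
  have hM := h.screenMean_mem
  have hpos : ∀ k, 0 < ∏ l : Fin r, if (l : ℕ) < k then E.screenMean j os l else 1 := fun k =>
    Finset.prod_pos fun l _ => by split_ifs; exacts [(hM l).1, one_pos]
  have hmul : ∀ k, (∏ l : Fin r, if (l : ℕ) < k then E.screenMean j os l else 1) *
      (∏ l : Fin r, if k ≤ (l : ℕ) then E.screenMean j os l else 1)
      = ∏ l, E.screenMean j os l := by
    intro k
    rw [← Finset.prod_mul_distrib]
    refine Finset.prod_congr rfl fun l _ => ?_
    by_cases h : (l : ℕ) < k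
    · simp [h]
    · simp [h, not_lt.1 h]
  have hle : (∏ l : Fin r, if (l : ℕ) < k' then E.screenMean j os l else 1) ≤
      ∏ l : Fin r, if (l : ℕ) < k then E.screenMean j os l else 1 := by
    refine Finset.prod_le_prod (fun l _ => ?_) (fun l _ => ?_)
    · split_ifs; exacts [(hM l).1.le, zero_le_one]
    · by_cases h1 : (l : ℕ) < k
      · simp [h1, h1.trans_le hk]
      · simp only [h1, if_false]
        split_ifs; exacts [(hM l).2, le_rfl]
  -- After multiplication by the mean fit, the degree enters only through mean fit times price,
  -- which is nonincreasing in the degree.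
  have key : ∀ k, (∏ l : Fin r, if (l : ℕ) < k then E.screenMean j os l else 1) *
      E.outcomeIndex k j os v = v * ∏ l, E.screenMean j os l - (∏ l : Fin r, if (l : ℕ) < k then
        E.screenMean j os l else 1) * E.price j - E.cost := by
    intro k
    rw [← hmul k, outcomeIndex, searchIndex]
    have := (hpos k).ne'
    field_simp
  have h1 := mul_pos (hpos k) hv
  rw [key] at h1
  refine pos_of_mul_pos_right ?_ (hpos k').le
  rw [key]
  have := mul_le_mul_of_nonneg_right hle (E.price_nonneg j)
  linarith

lemma measurableSet_outcomeIndex_pos (k : ℕ) (j : Fin m) (os : List (WithTop (Fin r))) :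
    MeasurableSet {v | 0 < E.outcomeIndex k j os v} := by
  refine measurableSet_lt measurable_const ?_
  unfold outcomeIndex searchIndex
  fun_prop

end ScreenMarket
/-! ### Concentration of the likelihood -/

/-- Gibbs' inequality for Bernoulli laws: take logarithms and apply `log t ≤ t - 1` to `x / θ` and
`(1 - x) / (1 - θ)`, strictly for the former. -/
lemma rpow_mul_rpow_lt {θ x : ℝ} (hθ : 0 < θ) (hθ' : θ < 1) (hx : 0 ≤ x) (hx' : x ≤ 1)
    (hne : x ≠ θ) : x ^ θ * (1 - x) ^ (1 - θ) < θ ^ θ * (1 - θ) ^ (1 - θ) := by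
  have h1θ : 0 < 1 - θ := by linarith
  have hpos : 0 < θ ^ θ * (1 - θ) ^ (1 - θ) := by positivity
  rcases hx.eq_or_lt with rfl | hx
  · rwa [Real.zero_rpow hθ.ne', zero_mul]
  rcases hx'.eq_or_lt with rfl | hx'
  · rwa [sub_self, Real.zero_rpow h1θ.ne', mul_zero]
  have h1x : 0 < 1 - x := by linarith
  rw [Real.rpow_def_of_pos hx, Real.rpow_def_of_pos h1x, Real.rpow_def_of_pos hθ,
    Real.rpow_def_of_pos h1θ, ← Real.exp_add, ← Real.exp_add, Real.exp_lt_exp]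
  have e1 : Real.log x - Real.log θ < x / θ - 1 := by
    rw [← Real.log_div hx.ne' hθ.ne']
    exact Real.log_lt_sub_one_of_pos (by positivity) fun h => hne ((div_eq_one_iff_eq hθ.ne').1 h)
  have e2 : Real.log (1 - x) - Real.log (1 - θ) ≤ (1 - x) / (1 - θ) - 1 := by
    rw [← Real.log_div h1x.ne' h1θ.ne']
    exact Real.log_le_sub_one_of_pos (by positivity)
  have e3 := mul_lt_mul_of_pos_right e1 hθ
  have e4 := mul_le_mul_of_nonneg_right e2 h1θ.le
  have e5 : (x / θ - 1) * θ = x - θ := by field_simp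
  have e6 : ((1 - x) / (1 - θ) - 1) * (1 - θ) = θ - x := by field_simp; ring
  linarith

/-- Gibbs' inequality is strict on the compact set of `x` at distance at least `ε` from `θ`. By
continuity it survives there uniformly when `y` and the exponent `q` move slightly off `θ` and the
right-hand side is shrunk by a factor below one. -/
lemma exists_rpow_ratio {θ ε : ℝ} (hθ : 0 < θ) (hθ' : θ < 1) (hε : 0 < ε) :
    ∃ ρ : ℝ, 0 ≤ ρ ∧ ρ < 1 ∧ ∃ U ∈ 𝓝 θ, ∀ᶠ q in 𝓝 θ, ∀ x : ℝ, 0 ≤ x → x ≤ 1 → ε ≤ |x - θ| →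
      ∀ y ∈ U, x ^ q * (1 - x) ^ (1 - q) ≤ ρ * (y ^ q * (1 - y) ^ (1 - q)) := by
  set K : Set ℝ := Icc 0 1 ∩ {x | ε ≤ |x - θ|} with hK
  have hKc : IsCompact K := isCompact_Icc.inter_right
    (isClosed_le continuous_const (by fun_prop))
  have h1θ : 0 < 1 - θ := by linarith
  -- The triple `z` is (shrinking factor, `y`, `q`).
  have hev : ∀ᶠ z : ℝ × ℝ × ℝ in 𝓝 (1, θ, θ), ∀ x ∈ K,
      x ^ z.2.2 * (1 - x) ^ (1 - z.2.2) < z.1 * (z.2.1 ^ z.2.2 * (1 - z.2.1) ^ (1 - z.2.2)) := by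
    refine hKc.eventually_forall_of_forall_eventually fun x hx => ?_
    have hlt : x ^ θ * (1 - x) ^ (1 - θ) < 1 * (θ ^ θ * (1 - θ) ^ (1 - θ)) := by
      rw [one_mul]
      refine rpow_mul_rpow_lt hθ hθ' hx.1.1 hx.1.2 ?_
      rintro rfl
      have := hx.2
      simp at this
      linarith
    refine ContinuousAt.eventually_lt (x₀ := (((1, θ, θ), x) : (ℝ × ℝ × ℝ) × ℝ)) ?_ ?_ hlt
    · refine ContinuousAt.mul (ContinuousAt.rpow (by fun_prop) (by fun_prop) (Or.inr hθ))
        (ContinuousAt.rpow (by fun_prop) (by fun_prop) (Or.inr h1θ))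
    · refine ContinuousAt.mul (by fun_prop) (ContinuousAt.mul
        (ContinuousAt.rpow (by fun_prop) (by fun_prop) (Or.inr hθ))
        (ContinuousAt.rpow (by fun_prop) (by fun_prop) (Or.inr h1θ)))
  rw [nhds_prod_eq, nhds_prod_eq, eventually_prod_iff] at hev
  obtain ⟨p, hp, p', hp', h⟩ := hev
  rw [eventually_prod_iff] at hp'
  obtain ⟨a, ha, b, hb, h'⟩ := hp'
  obtain ⟨δ, hδ, hball⟩ := Metric.eventually_nhds_iff.1 hp
  refine ⟨max (1 - δ / 2) 0, le_max_right _ _, max_lt (by linarith) one_pos, {y | a y} ∩ Ioo 0 1,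
    inter_mem ha (Ioo_mem_nhds hθ hθ'), ?_⟩
  filter_upwards [hb] with q hq x hx0 hx1 hxε y hy
  have hpδ : p (1 - δ / 2) := hball (by
    rw [Real.dist_eq, abs_lt]
    constructor <;> linarith)
  refine (h hpδ (h' hy.1 hq) x ⟨⟨hx0, hx1⟩, hxε⟩).le.trans
    (mul_le_mul_of_nonneg_right (le_max_left _ _) ?_)
  have := hy.2.1
  have : 0 < 1 - y := by linarith [hy.2.2]
  positivity

/-- Likelihoods away from the limit frequency are exponentially small compared to those close
to it. -/
lemma exists_likelihood_ratio {θ ε : ℝ} (hθ : 0 < θ) (hθ' : θ ≤ 1) (hε : 0 < ε) {A B : ℕ → ℕ}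
    (hAB : Tendsto (fun n => A n + B n) atTop atTop)
    (hq : Tendsto (fun n => (A n : ℝ) / ((A n + B n : ℕ) : ℝ)) atTop (𝓝 θ))
    (hB : θ = 1 → ∀ n, B n = 0) :
    ∃ ρ : ℝ, 0 ≤ ρ ∧ ρ < 1 ∧ ∃ U ∈ 𝓝 θ, ∀ᶠ n in atTop, ∀ x : ℝ, 0 ≤ x → x ≤ 1 → ε ≤ |x - θ| →
      ∀ y ∈ U, 0 ≤ y → y ≤ 1 →
      x ^ A n * (1 - x) ^ B n ≤ ρ ^ (A n + B n) * (y ^ A n * (1 - y) ^ B n) := by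
  rcases hθ'.eq_or_lt with h1 | h1
  · subst h1
    -- For `θ = 1` there are no failures and the likelihood is a pure power. Here `x ≤ 1 - ε ≤ (1 -
    -- ε / 2) ^ 2`, while `y > 1 - ε / 2`; the maximum with `0` covers large `ε`.
    refine ⟨max (1 - ε / 2) 0, le_max_right _ _, max_lt (by linarith) one_pos, Ioi (1 - ε / 2),
      Ioi_mem_nhds (by linarith), Eventually.of_forall fun n x hx0 hx1 hxε y hy _ _ => ?_⟩
    rw [hB rfl n, pow_zero, mul_one, pow_zero, mul_one, add_zero, ← mul_pow]
    refine pow_le_pow_left₀ hx0 ?_ _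
    rw [abs_of_nonpos (by linarith)] at hxε
    have h2 : 0 ≤ 1 - ε / 2 := by linarith
    rw [max_eq_left h2]
    have := mul_le_mul_of_nonneg_left (le_of_lt (mem_Ioi.1 hy)) h2
    nlinarith
  · obtain ⟨ρ, h0, hρ, U, hU, hev⟩ := exists_rpow_ratio hθ h1 hε
    refine ⟨ρ, h0, hρ, U, hU, ?_⟩
    filter_upwards [hq.eventually hev, hAB.eventually_ge_atTop 1] with n hn hN x hx0 hx1 hxε y hy
      hy0 hy1
    have hNr : (0 : ℝ) < ((A n + B n : ℕ) : ℝ) := by exact_mod_cast hN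
    have key : ∀ t : ℝ, 0 ≤ t → t ≤ 1 → t ^ A n * (1 - t) ^ B n =
        (t ^ ((A n : ℝ) / ((A n + B n : ℕ) : ℝ)) *
          (1 - t) ^ (1 - (A n : ℝ) / ((A n + B n : ℕ) : ℝ))) ^ (A n + B n) := by
      intro t ht0 ht1
      rw [mul_pow, ← Real.rpow_natCast (_ ^ _), ← Real.rpow_natCast (_ ^ _), ← Real.rpow_mul ht0,
        ← Real.rpow_mul (by linarith), div_mul_cancel₀ _ hNr.ne', sub_mul,
        div_mul_cancel₀ _ hNr.ne', one_mul]
      push_cast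
      rw [add_sub_cancel_left, Real.rpow_natCast, Real.rpow_natCast]
    rw [key x hx0 hx1, key y hy0 hy1, ← mul_pow]
    refine pow_le_pow_left₀ ?_ (hn x hx0 hx1 hxε y hy) _
    exact mul_nonneg (Real.rpow_nonneg hx0 _) (Real.rpow_nonneg (by linarith) _)

/-- Averaging `f x ≤ c * f y` over `y ∈ U` bounds `μ U * f x` by `c` times the normalizing constant;
then integrate over `x ∈ K`. -/
lemma tilt_le_of_ratio {α : Type*} [MeasurableSpace α] {μ : Measure α} [IsProbabilityMeasure μ]
    {f : α → ℝ≥0∞} (hf : Measurable f) {K U : Set α} (hK : MeasurableSet K) {c : ℝ≥0∞}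
    (hU0 : μ U ≠ 0) (h : ∀ x ∈ K, ∀ y ∈ U, f x ≤ c * f y)
    (h0 : ∫⁻ x, f x ∂μ ≠ 0) (h1 : ∫⁻ x, f x ∂μ ≠ ∞) : tilt μ f K ≤ c / μ U := by
  have hx : ∀ x ∈ K, μ U * f x ≤ c * ∫⁻ y, f y ∂μ := by
    intro x hx
    calc μ U * f x = ∫⁻ _ in U, f x ∂μ := by rw [setLIntegral_const, mul_comm]
      _ ≤ ∫⁻ y in U, c * f y ∂μ := setLIntegral_mono (hf.const_mul c) (h x hx)
      _ ≤ ∫⁻ y, c * f y ∂μ := setLIntegral_le_lintegral _ _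
      _ = c * ∫⁻ y, f y ∂μ := lintegral_const_mul c hf
  have hKint : μ U * ∫⁻ x in K, f x ∂μ ≤ c * ∫⁻ y, f y ∂μ := by
    rw [← lintegral_const_mul _ hf]
    calc ∫⁻ x in K, μ U * f x ∂μ ≤ ∫⁻ _ in K, c * ∫⁻ y, f y ∂μ ∂μ :=
          setLIntegral_mono measurable_const hx
      _ = (c * ∫⁻ y, f y ∂μ) * μ K := setLIntegral_const _ _
      _ ≤ (c * ∫⁻ y, f y ∂μ) * 1 := by gcongr; exact prob_le_one
      _ = _ := mul_one _
  rw [tilt_apply hK, ENNReal.le_div_iff_mul_le (Or.inl hU0) (Or.inl (measure_ne_top μ U))]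
  calc (∫⁻ x, f x ∂μ)⁻¹ * (∫⁻ x in K, f x ∂μ) * μ U
      = (∫⁻ x, f x ∂μ)⁻¹ * (μ U * ∫⁻ x in K, f x ∂μ) := by ring
    _ ≤ (∫⁻ x, f x ∂μ)⁻¹ * (c * ∫⁻ y, f y ∂μ) := by gcongr
    _ = c * ((∫⁻ x, f x ∂μ)⁻¹ * ∫⁻ y, f y ∂μ) := by ring
    _ = c := by rw [ENNReal.inv_mul_cancel h0 h1, mul_one]

section Counts

variable {r : ℕ} (l : Fin r) (os : List (WithTop (Fin r)))

open Classical in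
/-- The number of outcomes in which screen `l` was passed. -/
noncomputable def passCount : ℕ := os.countP fun o => (l : WithTop (Fin r)) < o

open Classical in
/-- The number of outcomes in which screen `l` was the first to fail. -/
noncomputable def failCount : ℕ := os.countP fun o => o = (l : WithTop (Fin r))

/-- An outcome that fails before screen `l` says nothing about it, so the likelihood is Bernoulli in
the occasions on which `l` was reached. -/
lemma screenLikelihood_eq (t : unitInterval) :
    screenLikelihood l os t = (t : ℝ) ^ passCount l os * (1 - (t : ℝ)) ^ failCount l os := by
  classical
  induction os with
  | nil => simp [screenLikelihood, passCount, failCount]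
  | cons o os ih =>
    have h1 : screenLikelihood l (o :: os) t = screenFactor l o t * screenLikelihood l os t := by
      simp [screenLikelihood]
    rw [h1, ih, screenFactor]
    unfold passCount failCount
    rw [List.countP_cons, List.countP_cons]
    rcases lt_trichotomy (l : WithTop (Fin r)) o with h | h | h
    · simp [h, h.ne', pow_succ]; ring
    · subst h; simp [pow_succ]; ring
    · simp [h.not_gt, h.ne]

end Counts

/-! ### Consistency of the posterior -/

namespace ScreenMarket

variable {m r : ℕ} {E : ScreenMarket m r}

lemma tendsto_screenPosterior {j : Fin m} {l : Fin r} {os : ℕ → List (WithTop (Fin r))}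
    (hp : ∀ n, E.Possible j (os n))
    (hAB : Tendsto (fun n => passCount l (os n) + failCount l (os n)) atTop atTop)
    (hq : Tendsto (fun n => (passCount l (os n) : ℝ) /
      ((passCount l (os n) + failCount l (os n) : ℕ) : ℝ)) atTop (𝓝 (E.param j l : ℝ)))
    {ε : ℝ} (hε : 0 < ε) :
    Tendsto (fun n => E.screenPosterior j (os n) l {t | ε ≤ |(t : ℝ) - E.param j l|}) atTop
      (𝓝 0) := by
  obtain ⟨ρ, h0, hρ, U, hU, hev⟩ := exists_likelihood_ratio (E.param_pos j l) (E.param j l).2.2 hε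
    hAB hq (by
      -- If the true parameter is `1`, a recorded failure would have likelihood zero at the truth,
      -- against possibility.
      intro h1 n
      by_contra hn
      refine hp n l ?_
      rw [screenWeight, screenLikelihood_eq, h1, sub_self, zero_pow hn, mul_zero,
        ENNReal.ofReal_zero])
  set V : Set unitInterval := (↑) ⁻¹' U with hV
  have hVn : V ∈ 𝓝 (E.param j l) := continuous_subtype_val.continuousAt hU
  have hV0 : E.prior j l V ≠ 0 :=
    ((Measure.mem_support_iff_forall _).1 (E.param_mem_support j l) V hVn).ne'
  have hlim : Tendsto (fun n => ENNReal.ofReal (ρ ^ (passCount l (os n) + failCount l (os n)))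
      / E.prior j l V) atTop (𝓝 0) := by
    have h1 : Tendsto (fun n => ENNReal.ofReal (ρ ^ (passCount l (os n) + failCount l (os n))))
        atTop (𝓝 0) := by
      rw [← ENNReal.ofReal_zero]
      exact ENNReal.tendsto_ofReal ((tendsto_pow_atTop_nhds_zero_of_lt_one h0 hρ).comp hAB)
    simpa using ENNReal.Tendsto.div_const h1 (Or.inr hV0)
  refine tendsto_of_tendsto_of_tendsto_of_le_of_le' tendsto_const_nhds hlim
    (Eventually.of_forall fun _ => zero_le) ?_
  filter_upwards [hev] with n hn
  refine tilt_le_of_ratio (continuous_screenWeight l _).measurable ?_ hV0 ?_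
    ((hp n).lintegral_ne_zero l) (lintegral_screenWeight_ne_top j _ l)
  · exact measurableSet_le measurable_const (by fun_prop)
  · intro x hx y hy
    rw [screenWeight, screenWeight, ← ENNReal.ofReal_mul (by positivity)]
    refine ENNReal.ofReal_le_ofReal ?_
    rw [screenLikelihood_eq, screenLikelihood_eq]
    exact hn x x.2.1 x.2.2 hx y hy y.2.1 y.2.2

lemma Possible.businessPosterior_eval {j : Fin m} {os : List (WithTop (Fin r))}
    (h : E.Possible j os) (l : Fin r) {S : Set unitInterval} (hS : MeasurableSet S) :
    E.businessPosterior j os {y | y l ∈ S} = E.screenPosterior j os l S := by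
  have := h.isProbabilityMeasure_screenPosterior
  exact (measurePreserving_eval (E.screenPosterior j os) l).measure_preimage hS.nullMeasurableSet

/-- By continuity at the truth, a deviation of `φ` forces some screen parameter to deviate; a union
bound over the screens finishes. -/
lemma tendsto_businessPosterior {j : Fin m} {os : ℕ → List (WithTop (Fin r))}
    (hp : ∀ n, E.Possible j (os n))
    (h : ∀ l, ∀ ε : ℝ, 0 < ε → Tendsto (fun n =>
      E.screenPosterior j (os n) l {t | ε ≤ |(t : ℝ) - E.param j l|}) atTop (𝓝 0))
    {φ : (Fin r → unitInterval) → ℝ} (hφ : Continuous φ) {ε : ℝ} (hε : 0 < ε) :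
    Tendsto (fun n => E.businessPosterior j (os n) {y | ε ≤ |φ y - φ (E.param j)|}) atTop
      (𝓝 0) := by
  obtain ⟨δ, hδ, hball⟩ := Metric.continuous_iff.1 hφ (E.param j) ε hε
  have hsub : {y | ε ≤ |φ y - φ (E.param j)|} ⊆
      ⋃ l, {y : Fin r → unitInterval | y l ∈ {t : unitInterval | δ ≤ |(t : ℝ) - E.param j l|}} := by
    intro y hy
    by_contra hcon
    simp only [mem_iUnion, mem_ofPred_eq, not_exists, not_le] at hcon
    have hd : dist y (E.param j) < δ := (dist_pi_lt_iff hδ).2 fun l => by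
      rw [Subtype.dist_eq, Real.dist_eq]; exact hcon l
    have := hball y hd
    rw [Real.dist_eq] at this
    exact absurd hy (not_le.2 this)
  have hlim : Tendsto (fun n => ∑ l, E.screenPosterior j (os n) l
      {t | δ ≤ |(t : ℝ) - E.param j l|}) atTop (𝓝 0) := by
    simpa using tendsto_finsetSum Finset.univ fun l _ => h l δ hδ
  refine tendsto_of_tendsto_of_tendsto_of_le_of_le tendsto_const_nhds hlim
    (fun _ => zero_le) fun n => ?_
  refine (measure_mono hsub).trans ((measure_iUnion_fintype_le _ _).trans ?_)
  refine Finset.sum_le_sum fun l _ => le_of_eq ?_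
  exact (hp n).businessPosterior_eval l (measurableSet_le measurable_const (by fun_prop))

lemma continuous_fitProb (k : ℕ) : Continuous (fitProb (r := r) k) :=
  continuous_finsetProd _ fun l _ => continuous_subtype_val.comp (continuous_apply l)

lemma continuous_quality (k : ℕ) : Continuous (quality (r := r) k) :=
  continuous_finsetProd _ fun l _ => continuous_subtype_val.comp (continuous_apply l)

/-! ### Degenerate posteriors -/

/-- After the outcomes `os` only the true parameters of business `j` are possible. -/
def Identified (E : ScreenMarket m r) (j : Fin m) (os : List (WithTop (Fin r))) : Prop :=
  ∀ l, ∀ᵐ t ∂E.prior j l, screenWeight l os t = 0 ∨ t = E.param j l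

/-- Likelihoods multiply, so a parameter once excluded stays excluded. -/
lemma Identified.append {j : Fin m} {os : List (WithTop (Fin r))} (h : E.Identified j os)
    (os' : List (WithTop (Fin r))) : E.Identified j (os ++ os') := by
  intro l
  filter_upwards [h l] with t ht
  rw [screenWeight_append]
  exact ht.imp_left fun h => by rw [h, zero_mul]

lemma Identified.businessPosterior_eq_zero {j : Fin m} {os : List (WithTop (Fin r))}
    (h : E.Identified j os) (hp : E.Possible j os) (φ : (Fin r → unitInterval) → ℝ) {ε : ℝ}
    (hε : 0 < ε) : E.businessPosterior j os {y | ε ≤ |φ y - φ (E.param j)|} = 0 := by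
  have := hp.isProbabilityMeasure_screenPosterior
  have hae : ∀ l, ∀ᵐ t ∂E.screenPosterior j os l, t = E.param j l := by
    intro l
    have hS : MeasurableSet {t : unitInterval | t ≠ E.param j l} :=
      (measurableSet_singleton _).compl
    rw [ae_iff, screenPosterior, tilt_apply hS]
    rw [(setLIntegral_eq_zero_iff hS (continuous_screenWeight l os).measurable).2, mul_zero]
    filter_upwards [h l] with t ht hne
    exact ht.resolve_right hne
  have hall : ∀ᵐ y ∂E.businessPosterior j os, ∀ l, y l = E.param j l :=
    ae_all_iff.2 fun l => (Measure.quasiMeasurePreserving_eval (E.screenPosterior j os) l).ae (hae l)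
  have h0 : ∀ᵐ y ∂E.businessPosterior j os, ¬ ε ≤ |φ y - φ (E.param j)| := by
    filter_upwards [hall] with y hy
    rw [funext hy, sub_self, abs_zero]
    exact not_le.2 hε
  simpa [ae_iff] using h0

/-- Knowing fit and quality means knowing the product of all screen parameters. Under a product
posterior this already determines each factor: moving one coordinate to another point of its
support, with the others at their positive true values, changes the product on an open set of
positive posterior mass. -/
lemma identified_of_businessPosterior {j : Fin m} {os : List (WithTop (Fin r))}
    (hp : E.Possible j os) {k : ℕ}
    (hfit : ∀ ε : ℝ, 0 < ε → E.businessPosterior j os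
      {y | ε ≤ |fitProb k y - fitProb k (E.param j)|} = 0)
    (hqual : ∀ ε : ℝ, 0 < ε → E.businessPosterior j os
      {y | ε ≤ |quality k y - quality k (E.param j)|} = 0) : E.Identified j os := by
  have := hp.isProbabilityMeasure_screenPosterior
  have key : ∀ φ : (Fin r → unitInterval) → ℝ, (∀ ε : ℝ, 0 < ε → E.businessPosterior j os
      {y | ε ≤ |φ y - φ (E.param j)|} = 0) →
      ∀ᵐ y ∂E.businessPosterior j os, φ y = φ (E.param j) := by
    intro φ hφ
    have : ∀ᵐ y ∂E.businessPosterior j os, ∀ n : ℕ,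
        ¬ 1 / ((n : ℝ) + 1) ≤ |φ y - φ (E.param j)| :=
      ae_all_iff.2 fun n => by
        rw [ae_iff]
        simpa using hφ (1 / ((n : ℝ) + 1)) Nat.one_div_pos_of_nat
    filter_upwards [this] with y hy
    by_contra hne
    obtain ⟨n, hn⟩ := exists_nat_one_div_lt (abs_pos.2 (sub_ne_zero.2 hne))
    exact hy n hn.le
  have hprod : ∀ᵐ y ∂E.businessPosterior j os, ∏ l, (y l : ℝ) = ∏ l, (E.param j l : ℝ) := by
    filter_upwards [key _ hfit, key _ hqual] with y h1 h2
    rw [← fitProb_mul_quality k, ← fitProb_mul_quality k, h1, h2]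
  have hopen : IsOpen {y : Fin r → unitInterval | ∏ l, (y l : ℝ) ≠ ∏ l, (E.param j l : ℝ)} :=
    isOpen_ne.preimage (continuous_finsetProd _ fun l _ =>
      continuous_subtype_val.comp (continuous_apply l))
  have hsupp : ∀ l, (E.screenPosterior j os l).support ⊆ {E.param j l} := by
    intro l y hy
    by_contra hne
    have hmem : Function.update (E.param j) l y ∈
        {y : Fin r → unitInterval | ∏ l, (y l : ℝ) ≠ ∏ l, (E.param j l : ℝ)} := by
      intro he
      rw [← Finset.mul_prod_erase _ _ (Finset.mem_univ l),
        ← Finset.mul_prod_erase _ _ (Finset.mem_univ l)] at he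
      have h1 : ∏ i ∈ Finset.univ.erase l, (Function.update (E.param j) l y i : ℝ)
          = ∏ i ∈ Finset.univ.erase l, (E.param j i : ℝ) :=
        Finset.prod_congr rfl fun i hi => by rw [Function.update_of_ne (Finset.ne_of_mem_erase hi)]
      rw [h1, Function.update_self] at he
      have h2 : ∏ i ∈ Finset.univ.erase l, (E.param j i : ℝ) ≠ 0 :=
        Finset.prod_ne_zero_iff.2 fun i _ => (E.param_pos j i).ne'
      exact hne (Subtype.ext (mul_right_cancel₀ h2 he))
    obtain ⟨u, hu, hsub⟩ := isOpen_pi_iff'.1 hopen _ hmem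
    have h0 : E.businessPosterior j os (Set.pi univ u) = 0 := measure_mono_null hsub hprod
    rw [businessPosterior, Measure.pi_pi] at h0
    refine Finset.prod_ne_zero_iff.2 (fun i _ => ?_) h0
    refine ((Measure.mem_support_iff_forall _).1 ?_ (u i) ((hu i).1.mem_nhds (hu i).2)).ne'
    rcases eq_or_ne i l with rfl | hil
    · simpa using hy
    · rw [Function.update_of_ne hil]; exact hp.param_mem_support i
  intro l
  have hS : MeasurableSet {t : unitInterval | t ≠ E.param j l} :=
    (measurableSet_singleton _).compl
  have h0 : E.screenPosterior j os l {t | t ≠ E.param j l} = 0 :=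
    measure_mono_null (fun t ht ht' => ht (hsupp l ht')) Measure.measure_compl_support
  rw [screenPosterior, tilt_apply hS, mul_eq_zero, ENNReal.inv_eq_zero] at h0
  have h1 := h0.resolve_left (lintegral_screenWeight_ne_top j os l)
  rw [setLIntegral_eq_zero_iff hS (continuous_screenWeight l os).measurable] at h1
  filter_upwards [h1] with t ht
  by_cases hne : t = E.param j l
  · exact Or.inr hne
  · exact Or.inl (ht hne)

end ScreenMarket
/-! ### Stacks of screens -/

/-- The outcomes of the first `n` screen sequences of business `j`. -/
def stackOutcomes {m r : ℕ} (ω : ℕ → Consumer m r) (j : Fin m) (n : ℕ) : List (WithTop (Fin r)) :=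
  (List.range n).map fun i => firstFailed ((ω i).2 j)

section Stack

variable {m r : ℕ} {k : ℕ} {s : Strategy m r}

lemma stackOutcomes_succ (ω : ℕ → Consumer m r) (j : Fin m) (n : ℕ) :
    stackOutcomes ω j (n + 1) = stackOutcomes ω j n ++ [firstFailed ((ω n).2 j)] := by
  simp [stackOutcomes, List.range_succ]

lemma exists_stackOutcomes_append (ω : ℕ → Consumer m r) (j : Fin m) {a b : ℕ} (h : a ≤ b) :
    ∃ os, stackOutcomes ω j b = stackOutcomes ω j a ++ os := by
  induction b, h using Nat.le_induction with
  | base => exact ⟨[], by simp⟩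
  | succ b _ ih =>
    obtain ⟨os, hos⟩ := ih
    exact ⟨os ++ [firstFailed ((ω b).2 j)], by rw [stackOutcomes_succ, hos, List.append_assoc]⟩

/-- Number of inspections of business `j` in the first `n` rounds of an infinite history. -/
def inspections (H : ℕ → Feedback m r) (j : Fin m) (n : ℕ) : ℕ :=
  (outs j (historyPrefix H n)).length

lemma inspections_succ_of_none {H : ℕ → Feedback m r} {j : Fin m} {n : ℕ}
    (h : (H n).outcome j = none) : inspections H j (n + 1) = inspections H j n := by
  rw [inspections, historyPrefix_succ, outs_concat_none h, inspections]

lemma inspections_succ_of_ne_none {H : ℕ → Feedback m r} {j : Fin m} {n : ℕ}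
    (h : (H n).outcome j ≠ none) : inspections H j (n + 1) = inspections H j n + 1 := by
  obtain ⟨o, ho⟩ := Option.ne_none_iff_exists'.1 h
  simp [inspections, historyPrefix_succ, outs_concat_some ho]

lemma monotone_inspections (H : ℕ → Feedback m r) (j : Fin m) : Monotone (inspections H j) := by
  refine monotone_nat_of_le_succ fun n => ?_
  by_cases h : (H n).outcome j = none
  · exact (inspections_succ_of_none h).ge
  · rw [inspections_succ_of_ne_none h]; omega

lemma tendsto_inspections_or_eventually_const (H : ℕ → Feedback m r) (j : Fin m) :
    Tendsto (inspections H j) atTop atTop ∨ ∃ a n₀, ∀ n ≥ n₀, inspections H j n = a := by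
  refine (tendsto_atTop_of_monotone (monotone_inspections H j)).imp_right ?_
  rintro ⟨a, ha⟩
  rw [nhds_discrete, tendsto_pure, eventually_atTop] at ha
  exact ⟨a, ha⟩

/-- In the stack model, the outcomes seen so far are the topmost ones of the stack. -/
lemma outs_process_stack (hs : ∀ h v, ∃ l, s h v = indexPlan l) (ω : ℕ → Consumer m r) (j : Fin m)
    (n : ℕ) : outs j (historyPrefix (process k s (stackReader m r) ω) n) =
      stackOutcomes ω j (inspections (process k s (stackReader m r) ω) j n) := by
  induction n with
  | zero => rfl
  | succ n ih =>
    by_cases h : (process k s (stackReader m r) ω n).outcome j = none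
    · rw [inspections_succ_of_none h, historyPrefix_succ, outs_concat_none h, ih]
    · rw [inspections_succ_of_ne_none h, historyPrefix_succ, stackOutcomes_succ, ← ih]
      obtain ⟨l, hl⟩ := hs (processUpTo k s (stackReader m r) ω n) (ω n).1
      refine outs_concat_some ?_
      rw [process, hl] at h ⊢
      rcases outcome_roundFeedback k l
        (fun j => (ω (stackReader m r (processUpTo k s (stackReader m r) ω n) j)).2 j) j with h' | h'
      · exact absurd h' h
      · rw [h', inspections, historyPrefix_process]
        rfl

lemma measurableSet_historyPrefix (n : ℕ) (T : Set (List (Feedback m r))) :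
    MeasurableSet {H : ℕ → Feedback m r | historyPrefix H n ∈ T} := by
  have h1 : {H : ℕ → Feedback m r | historyPrefix H n ∈ T} =
      (fun (H : ℕ → Feedback m r) (i : Fin n) => H i) ⁻¹' {g | List.ofFn g ∈ T} := by
    ext H
    have : historyPrefix H n = List.ofFn fun i : Fin n => H i := by
      refine List.ext_getElem (by simp [historyPrefix]) fun i h1 h2 => ?_
      simp [historyPrefix]
    simp only [mem_ofPred_eq, mem_preimage, this]
  rw [h1]
  exact (measurable_pi_lambda _ fun i => measurable_pi_apply _) MeasurableSet.of_discrete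

lemma measurable_comp_historyPrefix {α : Type*} [MeasurableSpace α] (g : List (Feedback m r) → α)
    (n : ℕ) : Measurable fun H : ℕ → Feedback m r => g (historyPrefix H n) :=
  fun S _ => measurableSet_historyPrefix n (g ⁻¹' S)

end Stack

namespace ScreenMarket

variable {m r : ℕ} {E : ScreenMarket m r} {k : ℕ} {s : Strategy m r}

lemma IsRational.exists_indexPlan (h : E.IsRational k s) (H : List (Feedback m r)) (v : ℝ) :
    ∃ l, s H v = indexPlan l := by
  obtain ⟨l, -, hl⟩ := h.index_rule H v
  exact ⟨l, hl⟩

/-! ### Almost sure properties of the stacks -/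

lemma map_screens_consumerLaw (x : Profile m r) (j : Fin m) :
    (E.consumerLaw x).map (fun c => c.2 j) = E.screenLaw j (x j) := by
  have h1 : MeasurePreserving (fun c : Consumer m r => c.2 j) (E.consumerLaw x)
      (E.screenLaw j (x j)) :=
    (measurePreserving_eval (fun j => E.screenLaw j (x j)) j).comp measurePreserving_snd
  exact h1.map_eq

lemma measurePreserving_screens (x : Profile m r) (i : ℕ) (j : Fin m) :
    MeasurePreserving (fun ω : ℕ → Consumer m r => (ω i).2 j) (E.streamLaw x)
      (E.screenLaw j (x j)) := by
  have h1 : MeasurePreserving (fun c : Consumer m r => c.2 j) (E.consumerLaw x)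
      (E.screenLaw j (x j)) := ⟨by fun_prop, map_screens_consumerLaw x j⟩
  exact h1.comp (measurePreserving_eval_infinitePi (fun _ => E.consumerLaw x) i)

/-- Indicator of passing the first `k` screens. -/
noncomputable def fitInd {r : ℕ} (k : ℕ) (f : Fin r → Bool) : ℝ := if fitOf k f = true then 1 else 0

/-- The law of large numbers is applied to the raw stack, inspected or not. Adaptive sampling thus
plays no role: a history only decides how far the stack is read. -/
lemma ae_tendsto_fit_frequency (x : Profile m r) (j : Fin m) (hk : k ≤ r) :
    ∀ᵐ ω ∂E.streamLaw x, Tendsto (fun n : ℕ =>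
      (∑ i ∈ Finset.range n, fitInd k ((ω i).2 j)) / n) atTop (𝓝 (fitProb k (x j))) := by
  have hmeas : Measurable (fitInd (r := r) k) := measurable_of_countable _
  have hmp := fun i => measurePreserving_screens (E := E) x i j
  have hlaw := strong_law_ae_real (μ := E.streamLaw x)
    (fun i ω => fitInd k ((ω i).2 j)) ?_ ?_ ?_
  · have hmean : ∫ ω, fitInd k ((ω 0).2 j) ∂E.streamLaw x = fitProb k (x j) := by
      rw [← integral_map (hmp 0).measurable.aemeasurable hmeas.aestronglyMeasurable (f := fitInd k),
        (hmp 0).map_eq]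
      have : fitInd (r := r) k = {f | fitOf k f = true}.indicator fun _ => 1 := by
        funext f
        simp [fitInd, indicator]
      rw [this, integral_indicator_const _ MeasurableSet.of_discrete, Measure.real,
        E.screenLaw_fitOf j (x j) hk, ENNReal.toReal_ofReal (fitProb_nonneg _ _)]
      simp
    rw [hmean] at hlaw
    exact hlaw
  · refine Integrable.of_bound (C := 1) (hmeas.comp (hmp 0).measurable).aestronglyMeasurable
      (Eventually.of_forall fun ω => ?_)
    unfold fitInd
    split_ifs <;> simp
  · intro a b hab
    have : iIndepFun (fun i (ω : ℕ → Consumer m r) => fitInd k ((ω i).2 j)) (E.streamLaw x) :=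
      iIndepFun_infinitePi (X := fun _ (c : Consumer m r) => fitInd k (c.2 j))
        fun _ => hmeas.comp (by fun_prop)
    exact this.indepFun hab
  · intro i
    refine ⟨(hmeas.comp (hmp i).measurable).aemeasurable,
      (hmeas.comp (hmp 0).measurable).aemeasurable, ?_⟩
    have h1 : ∀ i, (E.streamLaw x).map (fun ω => fitInd k ((ω i).2 j))
        = (E.screenLaw j (x j)).map (fitInd k) := by
      intro i
      rw [← (hmp i).map_eq, Measure.map_map hmeas (hmp i).measurable]
      rfl
    rw [h1, h1]

lemma sum_fitInd_eq (ω : ℕ → Consumer m r) (j : Fin m) (l : Fin r) (n : ℕ) :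
    ∑ i ∈ Finset.range n, fitInd (l + 1) ((ω i).2 j) = passCount l (stackOutcomes ω j n) ∧
    ∑ i ∈ Finset.range n, fitInd l ((ω i).2 j) =
      ((passCount l (stackOutcomes ω j n) + failCount l (stackOutcomes ω j n) : ℕ) : ℝ) := by
  induction n with
  | zero => simp [stackOutcomes, passCount, failCount]
  | succ n ih =>
    rw [Finset.sum_range_succ, Finset.sum_range_succ, ih.1, ih.2, stackOutcomes_succ]
    unfold passCount failCount
    rw [List.countP_append, List.countP_append]
    simp only [fitInd, ← lt_firstFailed, ← le_firstFailed, List.countP_singleton,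
      decide_eq_true_eq]
    rcases lt_trichotomy (l : WithTop (Fin r)) (firstFailed ((ω n).2 j)) with h | h | h
    · simp [h, h.le, h.ne']; ring
    · simp [← h]; ring
    · simp [h.not_gt, h.not_ge, h.ne]

/-- Screen `l` is reached with the fit frequency of degree `l` and passed with that of degree `l +
1`; the ratio of the limits is the parameter. The first limit is positive, so the screen is reached
infinitely often. -/
lemma ae_tendsto_counts (j : Fin m) (l : Fin r) :
    ∀ᵐ ω ∂E.streamLaw E.param,
      Tendsto (fun n => passCount l (stackOutcomes ω j n) + failCount l (stackOutcomes ω j n))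
        atTop atTop ∧
      Tendsto (fun n => (passCount l (stackOutcomes ω j n) : ℝ) /
        ((passCount l (stackOutcomes ω j n) + failCount l (stackOutcomes ω j n) : ℕ) : ℝ)) atTop
        (𝓝 (E.param j l : ℝ)) := by
  filter_upwards [ae_tendsto_fit_frequency (E := E) E.param j l.2.le,
    ae_tendsto_fit_frequency (E := E) E.param j l.2] with ω h1 h2
  simp only [(sum_fitInd_eq ω j l _).1, (sum_fitInd_eq ω j l _).2] at h1 h2
  have hpos : 0 < fitProb l (E.param j) := fitProb_pos _ (E.param_pos j)
  constructor
  · rw [← tendsto_natCast_atTop_iff (R := ℝ)]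
    have h3 := h1.pos_mul_atTop hpos (tendsto_natCast_atTop_atTop (R := ℝ))
    refine h3.congr' ?_
    filter_upwards [eventually_gt_atTop 0] with n hn
    rw [div_mul_cancel₀]
    exact_mod_cast hn.ne'
  · have h3 := h2.div h1 hpos.ne'
    rw [fitProb_succ, mul_div_cancel_left₀ _ hpos.ne'] at h3
    refine h3.congr' ?_
    filter_upwards [eventually_gt_atTop 0] with n hn
    rw [Pi.div_apply, div_div_div_cancel_right₀]
    exact_mod_cast hn.ne'

lemma ae_possible_stackOutcomes :
    ∀ᵐ ω ∂E.streamLaw E.param, ∀ j n, E.Possible j (stackOutcomes ω j n) := by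
  have h1 : ∀ j : Fin m, ∀ i : ℕ, ∀ o : WithTop (Fin r), ∀ᵐ ω ∂E.streamLaw E.param,
      firstFailed ((ω i).2 j) = o → E.outcomeProb j (E.param j) o ≠ 0 := by
    intro j i o
    by_cases h0 : E.outcomeProb j (E.param j) o = 0
    · have := (measurePreserving_screens (E := E) E.param i j).measure_preimage
        (s := {z | firstFailed z = o}) MeasurableSet.of_discrete.nullMeasurableSet
      rw [← outcomeProb, h0] at this
      rw [ae_iff]
      refine measure_mono_null (fun ω hω => ?_) this
      simp only [mem_ofPred_eq, Classical.not_imp] at hω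
      exact hω.1
    · exact Eventually.of_forall fun _ _ => h0
  simp only [← ae_all_iff] at h1
  filter_upwards [h1] with ω hω j n l
  have h2 : ((stackOutcomes ω j n).map (E.outcomeProb j (E.param j))).prod ≠ 0 := by
    refine List.prod_ne_zero fun h0 => ?_
    obtain ⟨o, ho, h0⟩ := List.mem_map.1 h0
    obtain ⟨i, -, hi⟩ := List.mem_map.1 ho
    exact hω j i o hi h0
  rw [prod_outcomeProb] at h2
  exact Finset.prod_ne_zero_iff.1 h2 l (Finset.mem_univ l)

lemma ae_likelihood_ne_zero {ρ : Reader m r} (hs : ∀ h v, ∃ l, s h v = indexPlan l)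
    (hm : ∀ h p, MeasurableSet {v | s h v = p}) (hρ : IsFresh ρ) :
    ∀ᵐ ω ∂E.streamLaw E.param, ∀ n,
      E.likelihood k s (historyPrefix (process k s ρ ω) n) E.param ≠ 0 := by
  have h1 : ∀ h : List (Feedback m r), ∀ᵐ ω ∂E.streamLaw E.param,
      processUpTo k s ρ ω h.length = h → E.likelihood k s h E.param ≠ 0 := by
    intro h
    by_cases h0 : E.likelihood k s h E.param = 0
    · rw [likelihood_eq hs hm, ← streamLaw_processUpTo_eq hs hm hρ] at h0
      rw [ae_iff]
      refine measure_mono_null (fun ω hω => ?_) h0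
      simp only [mem_ofPred_eq, Classical.not_imp] at hω
      exact hω.1
    · exact Eventually.of_forall fun _ _ => h0
  filter_upwards [ae_all_iff.2 h1] with ω hω n
  rw [historyPrefix_process]
  exact hω _ (by rw [length_processUpTo])

/-- Outcome lists are countable, so null sets of attractive values can be discarded together. A
single realized positive index then certifies attractiveness on a nonnull set of values, in the form
to be set against `FinallyUnattractive`. -/
lemma ae_valueLaw_outcomeIndex_ne_zero (k : ℕ) :
    ∀ᵐ ω ∂E.streamLaw E.param, ∀ (n : ℕ) j os, 0 < E.outcomeIndex k j os (ω n).1 →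
      E.valueLaw {v | 0 < E.outcomeIndex k j os v} ≠ 0 := by
  refine ae_all_iff.2 fun n => ae_all_iff.2 fun j => ae_all_iff.2 fun os => ?_
  by_cases h0 : E.valueLaw {v | 0 < E.outcomeIndex k j os v} = 0
  · have hmp : MeasurePreserving (fun ω : ℕ → Consumer m r => (ω n).1) (E.streamLaw E.param)
        E.valueLaw :=
      (measurePreserving_fst (μ := E.valueLaw)
        (ν := Measure.pi fun j => E.screenLaw j (E.param j))).comp
        (measurePreserving_eval_infinitePi (fun _ => E.consumerLaw E.param) n)
    have := hmp.measure_preimage (measurableSet_outcomeIndex_pos (E := E) k j os).nullMeasurableSet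
    rw [h0] at this
    rw [ae_iff]
    refine measure_mono_null (fun ω hω => ?_) this
    simp only [mem_ofPred_eq, Classical.not_imp] at hω
    exact hω.1
  · exact Eventually.of_forall fun _ _ => h0

/-! ### Businesses worth inspecting are inspected infinitely often -/

/-- By independence, missing `B` in `t` consecutive rounds has probability the `t`-th power of a
number below one. -/
lemma ae_frequently_mem (x : Profile m r) {B : Set (Consumer m r)} (hB : MeasurableSet B)
    (h0 : E.consumerLaw x B ≠ 0) : ∀ᵐ ω ∂E.streamLaw x, ∀ n₀ : ℕ, ∃ n ≥ n₀, ω n ∈ B := by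
  refine ae_all_iff.2 fun n₀ => ?_
  have hlt : E.consumerLaw x Bᶜ < 1 := by
    rw [prob_compl_eq_one_sub hB]
    exact ENNReal.sub_lt_self ENNReal.one_ne_top one_ne_zero h0
  rw [ae_iff]
  refine le_antisymm (ge_of_tendsto' (ENNReal.tendsto_pow_atTop_nhds_zero_of_lt_one hlt)
    fun t => ?_) zero_le
  calc E.streamLaw x {ω | ¬∃ n ≥ n₀, ω n ∈ B}
      ≤ E.streamLaw x (((Finset.Ico n₀ (n₀ + t) : Finset ℕ) : Set ℕ).pi fun _ => Bᶜ) := by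
        refine measure_mono fun ω hω n hn => ?_
        simp only [mem_ofPred_eq, not_exists, not_and] at hω
        exact hω n (Finset.mem_Ico.1 hn).1
    _ = E.consumerLaw x Bᶜ ^ t := by
        rw [streamLaw, Measure.infinitePi_pi _ fun _ _ => hB.compl]
        simp

/-- Fit probabilities below one enter here: independence over businesses gives a positive chance
that nothing fits, so that no search is cut short. -/
lemma consumerLaw_noFit_ne_zero (hk : k ≤ r)
    (hfit : ∀ j, fitProb k (E.param j) ∈ Set.Ioo (0 : ℝ) 1) {A : Set ℝ} (hA : E.valueLaw A ≠ 0) :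
    E.consumerLaw E.param (A ×ˢ {f | ∀ j, fitOf k (f j) = false}) ≠ 0 := by
  have h1 : {f : Fin m → Fin r → Bool | ∀ j, fitOf k (f j) = false} =
      Set.pi univ fun _ => {z | fitOf k z = true}ᶜ := by
    ext f
    simp [Set.mem_pi]
  rw [consumerLaw, Measure.prod_prod, h1, Measure.pi_pi]
  refine mul_ne_zero hA (Finset.prod_ne_zero_iff.2 fun j _ => ?_)
  rw [prob_compl_eq_one_sub MeasurableSet.of_discrete, E.screenLaw_fitOf j _ hk]
  exact (tsub_pos_of_lt (ENNReal.ofReal_lt_one.2 (hfit j).2)).ne'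

/-- Along `H`, a business that is inspected finitely often has a nonpositive index in the end. -/
def FinallyUnattractive (E : ScreenMarket m r) (k : ℕ) (H : ℕ → Feedback m r) : Prop :=
  ∀ j n₀, (∀ n ≥ n₀, (H n).outcome j = none) →
    E.valueLaw {v | 0 < E.outcomeIndex k j (outs j (historyPrefix H n₀)) v} = 0

lemma measurableSet_finallyUnattractive :
    MeasurableSet {H : ℕ → Feedback m r | E.FinallyUnattractive k H} := by
  have : {H : ℕ → Feedback m r | E.FinallyUnattractive k H} = ⋂ j, ⋂ n₀,
      ((⋂ n, ⋂ (_ : n ≥ n₀), (fun H : ℕ → Feedback m r => H n) ⁻¹' {fb | fb.outcome j = none})ᶜ ∪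
        {H | historyPrefix H n₀ ∈
          {h | E.valueLaw {v | 0 < E.outcomeIndex k j (outs j h) v} = 0}}) := by
    ext H
    simp only [FinallyUnattractive, mem_ofPred_eq, mem_iInter, mem_union, mem_compl_iff,
      mem_preimage, imp_iff_not_or]
  rw [this]
  refine MeasurableSet.iInter fun j => MeasurableSet.iInter fun n₀ =>
    (MeasurableSet.compl ?_).union (measurableSet_historyPrefix n₀ _)
  exact MeasurableSet.iInter fun n => MeasurableSet.iInter fun _ => measurable_pi_apply n trivial

/-- Once `j` is no longer inspected its index is frozen as a function of the value. If it were
positive on a nonnull set, a later consumer with such a value and no fit anywhere would inspect `j`.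
The argument is run in the stream model, where each round has fresh screens of its own, and is
carried to the stack by equality of laws. -/
lemma IsRational.ae_finallyUnattractive_stream (hr : E.IsRational k s) (hk : k ≤ r)
    (hfit : ∀ j, fitProb k (E.param j) ∈ Set.Ioo (0 : ℝ) 1) :
    ∀ᵐ ω ∂E.streamLaw E.param, E.FinallyUnattractive k (process k s (streamReader m r) ω) := by
  -- The frozen outcome list is random, so all of the countably many lists are treated at once.
  have hBC : ∀ᵐ ω ∂E.streamLaw E.param, ∀ j os,
      E.valueLaw {v | 0 < E.outcomeIndex k j os v} ≠ 0 → ∀ n₀ : ℕ, ∃ n ≥ n₀,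
        ω n ∈ {v | 0 < E.outcomeIndex k j os v} ×ˢ
          {f : Fin m → Fin r → Bool | ∀ j, fitOf k (f j) = false} := by
    refine ae_all_iff.2 fun j => ae_all_iff.2 fun os => ?_
    by_cases h0 : E.valueLaw {v | 0 < E.outcomeIndex k j os v} = 0
    · exact Eventually.of_forall fun _ h => absurd h0 h
    · filter_upwards [ae_frequently_mem E.param
        ((measurableSet_outcomeIndex_pos k j os).prod MeasurableSet.of_discrete)
        (consumerLaw_noFit_ne_zero hk hfit h0)] with ω hω _
      exact hω
  filter_upwards [hBC, ae_likelihood_ne_zero (k := k) hr.exists_indexPlan hr.measurable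
    (isFresh_streamReader m r)] with ω h1 h2 j n₀ hnone
  by_contra h0
  obtain ⟨n, hn, hv, hf⟩ := h1 j _ h0 n₀
  have houts : outs j (historyPrefix (process k s (streamReader m r) ω) n) =
      outs j (historyPrefix (process k s (streamReader m r) ω) n₀) := by
    induction n, hn using Nat.le_induction with
    | base => rfl
    | succ i hi ih =>
      clear hv hf
      rw [historyPrefix_succ, outs_concat_none (hnone i hi)]
      clear ih
      induction i, hi using Nat.le_induction with
      | base => rfl
      | succ i hi ih => rw [historyPrefix_succ, outs_concat_none (hnone i hi), ih]
  rw [mem_ofPred_eq, ← houts, ← searchIndex_mean hr.exists_indexPlan hr.measurable (h2 n) j] at hv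
  obtain ⟨l, hl, hsl⟩ := hr.index_rule (historyPrefix (process k s (streamReader m r) ω) n) (ω n).1
  have hjl : j ∈ l := (hl.2.1 j).2 hv
  refine outcome_ne_none_of_no_fit k l _ hf hjl ?_
  rw [← hsl, historyPrefix_process]
  have := hnone n hn
  simpa only [process, streamReader, length_processUpTo] using this

lemma IsRational.ae_finallyUnattractive_stack (hr : E.IsRational k s) (hk : k ≤ r)
    (hfit : ∀ j, fitProb k (E.param j) ∈ Set.Ioo (0 : ℝ) 1) :
    ∀ᵐ ω ∂E.streamLaw E.param, E.FinallyUnattractive k (process k s (stackReader m r) ω) := by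
  have h1 := (ae_map_iff (measurable_process (k := k) hr.exists_indexPlan hr.measurable
    (isFresh_streamReader m r)).aemeasurable measurableSet_finallyUnattractive).2
    (hr.ae_finallyUnattractive_stream hk hfit)
  rw [map_process_congr hr.exists_indexPlan hr.measurable (isFresh_streamReader m r)
    (isFresh_stackReader m r)] at h1
  exact ae_of_ae_map (measurable_process (k := k) hr.exists_indexPlan hr.measurable
    (isFresh_stackReader m r)).aemeasurable h1

/-! ### The learned set -/

/-- Countably many tolerances suffice, which makes learning a measurable event. -/
lemma mem_learnedSet_iff {H : ℕ → Feedback m r} {j : Fin m} :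
    j ∈ E.learnedSet k s H ↔ ∀ i : ℕ,
      Tendsto (fun n => E.posterior k s (historyPrefix H n)
        {x | 1 / ((i : ℝ) + 1) ≤ |fitProb k (x j) - fitProb k (E.param j)|}) atTop (𝓝 0) ∧
      Tendsto (fun n => E.posterior k s (historyPrefix H n)
        {x | 1 / ((i : ℝ) + 1) ≤ |quality k (x j) - quality k (E.param j)|}) atTop (𝓝 0) := by
  constructor
  · exact fun h i => h _ Nat.one_div_pos_of_nat
  · intro h ε hε
    obtain ⟨i, hi⟩ := exists_nat_one_div_lt hε
    have key : ∀ φ : Profile m r → ℝ, Tendsto (fun n => E.posterior k s (historyPrefix H n)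
        {x | 1 / ((i : ℝ) + 1) ≤ φ x}) atTop (𝓝 0) → Tendsto (fun n =>
        E.posterior k s (historyPrefix H n) {x | ε ≤ φ x}) atTop (𝓝 0) := fun φ hφ =>
      tendsto_of_tendsto_of_tendsto_of_le_of_le tendsto_const_nhds hφ (fun _ => zero_le)
        fun n => measure_mono fun x hx => hi.le.trans hx
    exact ⟨key _ (h i).1, key _ (h i).2⟩

lemma measurableSet_mem_learnedSet (j : Fin m) :
    MeasurableSet {H : ℕ → Feedback m r | j ∈ E.learnedSet k s H} := by
  simp only [mem_learnedSet_iff, ofPred_forall, ofPred_and]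
  refine MeasurableSet.iInter fun i => MeasurableSet.inter ?_ ?_ <;>
  exact measurableSet_tendsto _ fun n => measurable_comp_historyPrefix
    (fun h => E.posterior k s h _) n

lemma mem_learnedSet_iff_businessPosterior {H : ℕ → Feedback m r} {j : Fin m}
    (hr : E.IsRational k s) (h0 : ∀ n, E.likelihood k s (historyPrefix H n) E.param ≠ 0) :
    j ∈ E.learnedSet k s H ↔ ∀ ε : ℝ, 0 < ε →
      Tendsto (fun n => E.businessPosterior j (outs j (historyPrefix H n))
        {y | ε ≤ |fitProb k y - fitProb k (E.param j)|}) atTop (𝓝 0) ∧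
      Tendsto (fun n => E.businessPosterior j (outs j (historyPrefix H n))
        {y | ε ≤ |quality k y - quality k (E.param j)|}) atTop (𝓝 0) := by
  have key : ∀ {φ : (Fin r → unitInterval) → ℝ}, Continuous φ → ∀ (ε : ℝ) (n : ℕ),
      E.businessPosterior j (outs j (historyPrefix H n)) {y | ε ≤ |φ y - φ (E.param j)|} =
      E.posterior k s (historyPrefix H n) {x | ε ≤ |φ (x j) - φ (E.param j)|} := by
    intro φ hφ ε n
    rw [← map_posterior hr.exists_indexPlan hr.measurable (h0 n) j,
      Measure.map_apply (measurable_pi_apply j)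
        (measurableSet_le measurable_const (hφ.measurable.sub_const _).abs)]
    rfl
  simp only [key (continuous_fitProb k), key (continuous_quality k)]
  rfl

/-- With common values and common stacks of screens, a larger search degree learns more. -/
theorem ae_learnedSet_subset {k' : ℕ} {s' : Strategy m r} (hkk' : k ≤ k') (hk'r : k' ≤ r)
    (hfit' : ∀ j, fitProb k' (E.param j) ∈ Set.Ioo (0 : ℝ) 1)
    (hr : E.IsRational k s) (hr' : E.IsRational k' s') :
    ∀ᵐ ω ∂E.streamLaw E.param, E.learnedSet k s (process k s (stackReader m r) ω) ⊆
      E.learnedSet k' s' (process k' s' (stackReader m r) ω) := by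
  have hcounts := ae_all_iff.2 fun j => ae_all_iff.2 fun l => ae_tendsto_counts (E := E) j l
  filter_upwards [hcounts, ae_possible_stackOutcomes (E := E),
    ae_likelihood_ne_zero (k := k) hr.exists_indexPlan hr.measurable (isFresh_stackReader m r),
    ae_likelihood_ne_zero (k := k') hr'.exists_indexPlan hr'.measurable (isFresh_stackReader m r),
    ae_valueLaw_outcomeIndex_ne_zero (E := E) k,
    hr'.ae_finallyUnattractive_stack hk'r hfit'] with ω hc hp hl hl' hidx hfin j hj
  set H := process k s (stackReader m r) ω with hH
  set H' := process k' s' (stackReader m r) ω with hH'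
  have houts : ∀ n, outs j (historyPrefix H n) = stackOutcomes ω j (inspections H j n) :=
    outs_process_stack hr.exists_indexPlan ω j
  have houts' : ∀ n, outs j (historyPrefix H' n) = stackOutcomes ω j (inspections H' j n) :=
    outs_process_stack hr'.exists_indexPlan ω j
  rw [mem_learnedSet_iff_businessPosterior hr hl] at hj
  rw [mem_learnedSet_iff_businessPosterior hr' hl']
  simp only [houts] at hj
  simp only [houts']
  -- Infinitely many inspections at the larger degree read the whole stack, so consistency alone
  -- gives learning. Only the case of finitely many uses that `j` is learned at the smaller degree.
  rcases tendsto_inspections_or_eventually_const H' j with hinf | ⟨a, n₀, ha⟩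
  · intro ε hε
    have h1 : ∀ {φ : (Fin r → unitInterval) → ℝ}, Continuous φ → Tendsto (fun n =>
        E.businessPosterior j (stackOutcomes ω j n) {y | ε ≤ |φ y - φ (E.param j)|}) atTop (𝓝 0) :=
      fun hφ => tendsto_businessPosterior (fun n => hp j n)
        (fun l ε hε => tendsto_screenPosterior (fun n => hp j n) (hc j l).1 (hc j l).2 hε) hφ hε
    exact ⟨(h1 (continuous_fitProb k')).comp hinf, (h1 (continuous_quality k')).comp hinf⟩
  · have hnone : ∀ n ≥ n₀, (H' n).outcome j = none := by
      intro n hn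
      by_contra h
      have := inspections_succ_of_ne_none h
      rw [ha n hn, ha (n + 1) (by omega)] at this
      omega
    have hzero := hfin j n₀ hnone
    rw [houts', ha n₀ le_rfl] at hzero
    -- An inspection of `j` beyond the `a`-th would start from the very outcomes at which the other
    -- market gave up, with a positive index there; positivity carries over to the larger degree and
    -- contradicts `hzero`.
    have hle : ∀ n, inspections H j n ≤ a := by
      intro n
      induction n with
      | zero => exact Nat.zero_le _
      | succ n ih =>
        by_cases h : (H n).outcome j = none
        · rwa [inspections_succ_of_none h]
        rw [inspections_succ_of_ne_none h]
        refine Nat.lt_of_le_of_ne ih fun he => ?_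
        obtain ⟨l, hl1, hl2⟩ := hr.index_rule (historyPrefix H n) (ω n).1
        have hjl : j ∈ l := by
          refine mem_of_outcome_ne_none k l
            (fun j => (ω (stackReader m r (processUpTo k s (stackReader m r) ω n) j)).2 j) ?_
          rw [← hl2, hH, historyPrefix_process]
          exact h
        have hpos := (hl1.2.1 j).1 hjl
        simp only [searchIndex_mean hr.exists_indexPlan hr.measurable (hl n), houts, he] at hpos
        refine hidx n j _ hpos (measure_mono_null (fun v hv => ?_) hzero)
        exact (hp j a).outcomeIndex_pos hkk' hv
    rcases tendsto_inspections_or_eventually_const H j with hinf | ⟨b, n₁, hb⟩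
    · obtain ⟨n, hn⟩ := (hinf.eventually_ge_atTop (a + 1)).exists
      exact absurd (hle n) (by omega)
    · have hba : b ≤ a := by rw [← hb n₁ le_rfl]; exact hle n₁
      have hlim : ∀ S : Set (Fin r → unitInterval), Tendsto (fun n =>
          E.businessPosterior j (stackOutcomes ω j (inspections H j n)) S) atTop (𝓝 0) →
          E.businessPosterior j (stackOutcomes ω j b) S = 0 := fun S hS =>
        tendsto_nhds_unique (tendsto_const_nhds.congr' (by
          filter_upwards [eventually_ge_atTop n₁] with n hn
          rw [hb n hn])) hS
      -- The posterior stays constant after `b` outcomes, so its convergence to the truth means that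
      -- it is already degenerate.
      have hid : E.Identified j (stackOutcomes ω j b) := identified_of_businessPosterior (hp j b)
        (fun ε hε => hlim _ (hj ε hε).1) (fun ε hε => hlim _ (hj ε hε).2)
      obtain ⟨os, hos⟩ := exists_stackOutcomes_append ω j hba
      have hid' : E.Identified j (stackOutcomes ω j a) := hos ▸ hid.append os
      intro ε hε
      constructor <;>
      · refine tendsto_const_nhds.congr' ?_
        filter_upwards [eventually_ge_atTop n₀] with n hn
        rw [ha n hn]
        exact (hid'.businessPosterior_eq_zero (hp j a) _ hε).symm

end ScreenMarket
end AgenticMarket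

/-! ### The coupling -/

theorem mainTheorem2 {m r : ℕ} (E : AgenticMarket.ScreenMarket m r) (k k' : ℕ)
    (hkk' : k ≤ k') (hk'r : k' ≤ r)
    (hfit : ∀ j, AgenticMarket.fitProb k (E.param j) ∈ Set.Ioo (0 : ℝ) 1)
    (hfit' : ∀ j, AgenticMarket.fitProb k' (E.param j) ∈ Set.Ioo (0 : ℝ) 1)
    (s s' : AgenticMarket.Strategy m r) (hs : E.IsRational k s) (hs' : E.IsRational k' s') :
    ∃ Γ : MeasureTheory.Measure
        ((ℕ → AgenticMarket.Feedback m r) × (ℕ → AgenticMarket.Feedback m r)),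
      MeasureTheory.IsProbabilityMeasure Γ ∧
      Γ.map Prod.fst = E.historyLaw k s ∧
      Γ.map Prod.snd = E.historyLaw k' s' ∧
      ∀ᵐ H ∂Γ,
        E.learnedSet k s H.1 ⊆ E.learnedSet k' s' H.2 ∧
        E.limitUtility k s H.1 ≤ E.limitUtility k' s' H.2 := by
  open AgenticMarket AgenticMarket.ScreenMarket in
  have hstack := isFresh_stackReader m r
  have hm1 := measurable_process (k := k) hs.exists_indexPlan hs.measurable hstack
  have hm2 := measurable_process (k := k') hs'.exists_indexPlan hs'.measurable hstack
  have hm : Measurable fun ω => (process k s (stackReader m r) ω,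
    process k' s' (stackReader m r) ω) := hm1.prodMk hm2
  -- One stream drives both markets through the stack reader: common values by round, common screens
  -- by inspection number. Each marginal is the true history law because the law does not depend on
  -- the reader.
  refine ⟨(E.streamLaw E.param).map fun ω => (process k s (stackReader m r) ω,
    process k' s' (stackReader m r) ω), Measure.isProbabilityMeasure_map hm.aemeasurable,
    ?_, ?_, ?_⟩
  · rw [Measure.map_map measurable_fst hm, historyLaw, history_eq_process]
    exact map_process_congr hs.exists_indexPlan hs.measurable hstack (isFresh_streamReader m r) _
  · rw [Measure.map_map measurable_snd hm, historyLaw, history_eq_process]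
    exact map_process_congr hs'.exists_indexPlan hs'.measurable hstack (isFresh_streamReader m r) _
  · have hsub : ∀ᵐ H ∂(E.streamLaw E.param).map fun ω => (process k s (stackReader m r) ω,
        process k' s' (stackReader m r) ω), E.learnedSet k s H.1 ⊆ E.learnedSet k' s' H.2 := by
      -- Passing from streams to pairs of histories requires the inclusion to be a measurable event;
      -- it is an intersection over businesses.
      refine (ae_map_iff hm.aemeasurable ?_).2 (ae_learnedSet_subset hkk' hk'r hfit' hs hs')
      have : {H : (ℕ → Feedback m r) × (ℕ → Feedback m r) |
          E.learnedSet k s H.1 ⊆ E.learnedSet k' s' H.2} =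
          ⋂ j, ((Prod.fst ⁻¹' {H | j ∈ E.learnedSet k s H})ᶜ ∪
            Prod.snd ⁻¹' {H | j ∈ E.learnedSet k' s' H}) := by
        ext H
        simp only [mem_ofPred_eq, mem_iInter, mem_union, mem_compl_iff, mem_preimage,
          ← imp_iff_not_or]
        rfl
      rw [this]
      exact MeasurableSet.iInter fun j =>
        ((measurable_fst (measurableSet_mem_learnedSet j)).compl).union
          (measurable_snd (measurableSet_mem_learnedSet j))
    filter_upwards [hsub] with H hH
    exact ⟨hH, E.optimalUtility_mono hkk' hH⟩
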